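/- Let $N=\{1,\dots,n\}$ be a set of base transceiver stations (BTSs). BTS $i$ has packet arrival rate $\lambda_i>0$ and spectral efficiencies $s_{i,A}\ge 0$ ($A\subseteq N$) with $s_{i,A}=0$ if $i\notin A$ and $s_{i,A}\ge s_{i,B}$ if $i\in A\subseteq B$. The spectrum is allocated by $(x_B)_{B\subseteq N}$ with $x_B\ge 0$ and $\sum_B x_B=1$. When $A$ is the set of active BTSs, BTS $i$ serves at rate $r_{i,A}=\sum_{B\subseteq N}s_{i,B\cap A}\,x_B$. Assume $r_{i,N}>\lambda_i$ for all $i\in N$. The lumped chain is the continuous-time Markov chain on the $2^n$ subsets of $N$ with transition rates $\lambda_i$ from $A$ to $A\cup\{i\}$ ($i\notin A$) and $r_{i,A}-\lambda_i$ from $A$ to $A\setminus\{i\}$ ($i\in A$), and no other transitions. It has exactly one stationary distribution $p$. In the modified queueing system, the set of active BTSs has distribution $p$ and, given that it equals $A$, the queue lengths are independent, queue $j\in A$ having length $l\ge1$ with probability $\left(1-\frac{\lambda_j}{r_{j,A}}\right)\left(\frac{\lambda_j}{r_{j,A}}\right)^{l-1}$ and queues $j\notin A$ being empty. The mean length of queue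 $i$ is then finite and equal to $\lambda_i t_i$, where $$t_i=\sum_{A\ni i}\frac{p(A)\,r_{i,A}}{(r_{i,A}-\lambda_i)\lambda_i}$$ is the refined approximate mean sojourn time. For $i\in N$ put $$\bar t_i=\sum_{A\subseteq N\setminus\{i\}}\bar\pi_i(A)\,\frac1{r_{i,A\cup\{i\}}-\lambda_i},\qquad \underline t_i=\frac1{\sum_{A\subseteq N\setminus\{i\}}\underline\pi_i(A)\,r_{i,A\cup\{i\}}-\lambda_i},$$ the second-degree upper and lower bounds, where $$\bar\pi_i(A)=\prod_{j\in A}\bar p_j\prod_{j\notin A,\,j\ne i}(1-\bar p_j),\quad \bar p_j=\frac{\lambda_j}{r_{j,N}},\qquad \underline\pi_i(A)=\prod_{j\in A}\underline p_j\prod_{j\notin A,\,j\ne i}(1-\underline p_j),\quad \underline p_j=\frac{\lambda_j}{r_{j,\{j\}}}.$$ Then $\underline t_i\le t_i\le\bar t_i$ for every $i\in N$, and $\underline t_i<t_i<\bar t_i$ for every $i\in N$ with $r_{i,N}<r_{i,\{i\}}$, that is, for every BTS whose service rate is affected by interference at all. -/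

import Mathlib

noncomputable section

/-- Data of a network of `n` base transceiver stations (BTSs), indexed by `Fin n`: the arrival
rates, the spectral efficiencies (in packets per second for the whole band) and an allocation of
the spectrum to the `2 ^ n` reuse patterns. -/
structure BTSNetwork (n : ℕ) where
  /-- Poisson arrival rate of packets at each BTS. -/
  arr : Fin n → ℝ
  /-- `eff i A` is the spectral efficiency of BTS `i` when the set of active BTSs is `A`. -/
  eff : Fin n → Finset (Fin n) → ℝ
  /-- `band B` is the fraction of the spectrum shared by exactly the BTSs in `B`. -/
  band : Finset (Fin n) → ℝ
  arr_pos : ∀ i, 0 < arr i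
  eff_nonneg : ∀ i A, 0 ≤ eff i A
  eff_inactive : ∀ i A, i ∉ A → eff i A = 0
  eff_antitone : ∀ i A B, i ∈ A → A ⊆ B → eff i B ≤ eff i A
  band_nonneg : ∀ B, 0 ≤ band B
  band_sum : ∑ B, band B = 1

namespace BTSNetwork

variable {n : ℕ} (S : BTSNetwork n)

/-- Service rate `r_{i,A}` of BTS `i` when the set of active BTSs is `A`. -/
def rate (i : Fin n) (A : Finset (Fin n)) : ℝ :=
  ∑ B : Finset (Fin n), S.eff i (B ∩ A) * S.band B

/-- Stability within every group of states: even the worst-case service rate of each BTS exceeds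
its arrival rate. -/
def Stable : Prop := ∀ i, S.arr i < S.rate i Finset.univ

/-- Off-diagonal transition rates of the lumped chain, whose states are the sets of active BTSs
(on the diagonal this is `0`). At most one of the summands is nonzero. -/
def lumpedRate (A B : Finset (Fin n)) : ℝ :=
  (∑ i, if i ∉ A ∧ B = insert i A then S.arr i else 0) +
    ∑ i, if i ∉ B ∧ A = insert i B then S.rate i A - S.arr i else 0

/-- Generator (transition rate matrix) of the lumped chain. -/
def lumpedGenerator : Matrix (Finset (Fin n)) (Finset (Fin n)) ℝ :=
  fun A B => if A = B then -∑ C ∈ Finset.univ.erase A, S.lumpedRate A C else S.lumpedRate A B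

/-- `p` is a stationary probability distribution of the lumped chain. -/
def IsStationary (p : Finset (Fin n) → ℝ) : Prop :=
  (∀ A, 0 ≤ p A) ∧ ∑ A, p A = 1 ∧ Matrix.vecMul p S.lumpedGenerator = 0

/-- Intra-group distribution: the probability `p_i(l | A)` that queue `i` has length `l` given
that the set of active BTSs is `A`. It is geometric on `{1, 2, …}` if `i ∈ A`, and it is
concentrated at `0` otherwise. -/
def intraLaw (i : Fin n) (A : Finset (Fin n)) (l : ℕ) : ℝ :=
  if i ∈ A then
    if l = 0 then 0 else (1 - S.arr i / S.rate i A) * (S.arr i / S.rate i A) ^ (l - 1)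
  else if l = 0 then 1 else 0

/-- The set of active BTSs when the vector of queue lengths is `l`. -/
def activeSet (l : Fin n → ℕ) : Finset (Fin n) := Finset.univ.filter fun i => 0 < l i

/-- Joint distribution of the queue lengths in the modified system, for the distribution `p` of
the set of active BTSs. -/
def jointLaw (p : Finset (Fin n) → ℝ) (l : Fin n → ℕ) : ℝ :=
  p (activeSet l) * ∏ j, S.intraLaw j (activeSet l) (l j)

/-- The refined approximate mean sojourn time `t_i` at BTS `i`, for the distribution `p` of the
set of active BTSs. -/
def refinedSojourn (p : Finset (Fin n) → ℝ) (i : Fin n) : ℝ :=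
  ∑ A ∈ Finset.univ.filter (fun A : Finset (Fin n) => i ∈ A),
    p A * S.rate i A / ((S.rate i A - S.arr i) * S.arr i)

/-- Probability that the set of active BTSs other than `i` is `A`, when each BTS `j ≠ i` is active
with probability `a j`, independently. -/
def othersLaw (a : Fin n → ℝ) (i : Fin n) (A : Finset (Fin n)) : ℝ :=
  (∏ j ∈ A, a j) * ∏ j ∈ Finset.univ.erase i \ A, (1 - a j)

/-- Activity probability of BTS `j` at its worst rate `r_{j,N}`. -/
def worstActivity (j : Fin n) : ℝ := S.arr j / S.rate j Finset.univ

/-- Activity probability of BTS `j` at its best rate `r_{j,{j}}`. -/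
def bestActivity (j : Fin n) : ℝ := S.arr j / S.rate j {j}

/-- Second-degree upper bound on the mean sojourn time at BTS `i`. -/
def upperSojourn (i : Fin n) : ℝ :=
  ∑ A ∈ (Finset.univ.erase i).powerset,
    othersLaw S.worstActivity i A * (1 / (S.rate i (insert i A) - S.arr i))

/-- Second-degree lower bound on the mean sojourn time at BTS `i`. -/
def lowerSojourn (i : Fin n) : ℝ :=
  1 / ((∑ A ∈ (Finset.univ.erase i).powerset,
    othersLaw S.bestActivity i A * S.rate i (insert i A)) - S.arr i)

end BTSNetwork

end

/-! Write $X$ for the lumped chain and $g(y)=r_{i,y\cup\{i\}}$. The bounds are $E f(Y)$ with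
$f=1/(g-\lambda_i)$, and $1/(E g(Y)-\lambda_i)$, where the activities in $Y$ are independent, at
worst and best rates respectively. The proof couples $X$ with a chain $Y$ that resamples its
coordinates independently and so has this product law. For the upper bound the coupling keeps
$X\subseteq Y\cup\{i\}$, for the lower one $Y\subseteq X\cup\{i\}$. BTS $i$ is not driven by $Y$.

The inclusion alone is not enough: $h(y)=P(i\in X\mid Y=y)$ must also be increasing. Since $Y$ is
reversible, the conditional laws of $X$ given $Y=y$ satisfy a fixed-point equation whose operator
preserves positivity, the inclusion and monotonicity in $y$ (`IsKernel.move`). A fixed point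
therefore exists in the compact convex set of such kernels (`exists_stationary_kernel`), and its
marginal is the stationary law $p$. Testing with the indicator of $i\in X$ gives $Lh+\lambda_i=q$,
where $L$ generates $Y$ and $q(y)=E[r_{i,X}1_{i\in X}\mid Y=y]$ (`occupation_equation`).

Upper bound: $q\ge gh$ and $\lambda_i t_i\le E[fgh]\le E[fq]=\lambda_i E f+E[f\,Lh]\le\lambda_i E
f$, because $f$ and $h$ are both increasing and so $E[f\,Lh]\le0$.

Lower bound: $q\le gh$ and $\lambda_i=Eq\le E[gh]\le Eg\,Eh$ by positive correlation, $g$ being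
decreasing. Here $Eh=P(i\in X)$, and Jensen's inequality gives $t_i\ge1/(\lambda_i/Eh-\lambda_i)$.

Strictness: equality in either chain forces $q=gh$ and makes $h$ constant along every edge on which
$g$ drops. But $Lh+\lambda_i=gh$ with $h$ increasing excludes this (`not_monotone_of_resolvent`), so
$g$ could never drop and there would be no interference. -/

/-! ### Product Bernoulli laws: resampling, correlation and Dirichlet forms -/

section ProductBernoulli

variable {ι : Type*} [Fintype ι] [DecidableEq ι]

/-- Probability that exactly the coordinates in `A` succeed in independent Bernoulli trials with
success probabilities `a`. -/
def bernoulliWeight (a : ι → ℝ) (A : Finset ι) : ℝ := ∏ j, if j ∈ A then a j else 1 - a j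

/-- Expectation of `f` under the product Bernoulli law. -/
def bernoulliMean (a : ι → ℝ) (f : Finset ι → ℝ) : ℝ := ∑ A, bernoulliWeight a A * f A

/-- Conditional expectation of `f` given all coordinates but `j`. -/
def resample (a : ι → ℝ) (j : ι) (f : Finset ι → ℝ) (A : Finset ι) : ℝ :=
  a j * f (insert j A) + (1 - a j) * f (A.erase j)

theorem bernoulliWeight_nonneg {a : ι → ℝ} (h0 : ∀ j, 0 ≤ a j) (h1 : ∀ j, a j ≤ 1)
    (A : Finset ι) : 0 ≤ bernoulliWeight a A :=
  Finset.prod_nonneg fun j _ => by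
    split_ifs
    · exact h0 j
    · linarith [h1 j]

theorem bernoulliWeight_pos {a : ι → ℝ} (h0 : ∀ j, 0 < a j) (h1 : ∀ j, a j < 1)
    (A : Finset ι) : 0 < bernoulliWeight a A :=
  Finset.prod_pos fun j _ => by
    split_ifs
    · exact h0 j
    · linarith [h1 j]

theorem bernoulliWeight_eq (a : ι → ℝ) (A : Finset ι) :
    bernoulliWeight a A = (∏ j ∈ A, a j) * ∏ j ∈ Finset.univ \ A, (1 - a j) := by
  unfold bernoulliWeight
  rw [Finset.prod_ite]
  congr 1
  · exact Finset.prod_congr (by ext; simp) fun _ _ => rfl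
  · exact Finset.prod_congr (by ext; simp) fun _ _ => rfl

theorem sum_bernoulliWeight (a : ι → ℝ) : ∑ A, bernoulliWeight a A = 1 := by
  have h := Finset.prod_add a (fun j => 1 - a j) Finset.univ
  simp only [add_sub_cancel, Finset.prod_const_one, Finset.powerset_univ] at h
  rw [h]
  exact Finset.sum_congr rfl fun A _ => bernoulliWeight_eq a A

theorem bernoulliWeight_mul (a : ι → ℝ) (A B : Finset ι) :
    bernoulliWeight a A * bernoulliWeight a B
      = bernoulliWeight a (A ∩ B) * bernoulliWeight a (A ∪ B) := by
  unfold bernoulliWeight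
  rw [← Finset.prod_mul_distrib, ← Finset.prod_mul_distrib]
  refine Finset.prod_congr rfl fun j _ => ?_
  by_cases hA : j ∈ A <;> by_cases hB : j ∈ B <;> simp [hA, hB, mul_comm]

theorem bernoulliWeight_insert (a : ι → ℝ) (j : ι) (A : Finset ι) :
    bernoulliWeight a (insert j A)
      = a j * ∏ k ∈ Finset.univ.erase j, if k ∈ A then a k else 1 - a k := by
  unfold bernoulliWeight
  rw [← Finset.mul_prod_erase _ _ (Finset.mem_univ j)]
  congr 1
  · simp
  · refine Finset.prod_congr rfl fun k hk => ?_
    simp [Finset.ne_of_mem_erase hk]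

theorem bernoulliWeight_of_notMem (a : ι → ℝ) {j : ι} {A : Finset ι} (hj : j ∉ A) :
    bernoulliWeight a A
      = (1 - a j) * ∏ k ∈ Finset.univ.erase j, if k ∈ A then a k else 1 - a k := by
  unfold bernoulliWeight
  rw [← Finset.mul_prod_erase _ _ (Finset.mem_univ j)]
  simp [hj]

theorem sum_finset_eq_sum_powerset_erase (j : ι) (f : Finset ι → ℝ) :
    ∑ A, f A = ∑ A ∈ (Finset.univ.erase j).powerset, (f A + f (insert j A)) := by
  rw [Finset.sum_add_distrib, ← Finset.sum_powerset_insert (Finset.notMem_erase j _),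
    Finset.insert_erase (Finset.mem_univ j), Finset.powerset_univ]

theorem bernoulliMean_resample (a : ι → ℝ) (j : ι) (f : Finset ι → ℝ) :
    bernoulliMean a (resample a j f) = bernoulliMean a f := by
  unfold bernoulliMean
  rw [sum_finset_eq_sum_powerset_erase j, sum_finset_eq_sum_powerset_erase j]
  refine Finset.sum_congr rfl fun A hA => ?_
  have hj : j ∉ A := fun h => Finset.notMem_erase j _ (Finset.mem_powerset.1 hA h)
  rw [bernoulliWeight_insert a j A, bernoulliWeight_of_notMem a hj]
  simp only [resample, Finset.insert_idem, Finset.erase_insert hj, Finset.erase_eq_of_notMem hj]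
  ring

/-- Coordinate $i$ integrates out. This turns the sums over activity patterns of the other BTSs into
means over all coordinates. -/
theorem bernoulliMean_of_insensitive (a : ι → ℝ) (i : ι) (f : Finset ι → ℝ) :
    bernoulliMean a (fun A => f (insert i A)) =
      ∑ A ∈ (Finset.univ.erase i).powerset,
        ((∏ j ∈ A, a j) * ∏ j ∈ Finset.univ.erase i \ A, (1 - a j)) * f (insert i A) := by
  unfold bernoulliMean
  rw [sum_finset_eq_sum_powerset_erase i]
  refine Finset.sum_congr rfl fun A hA => ?_
  have hA' := Finset.mem_powerset.1 hA
  have hi : i ∉ A := fun h => Finset.notMem_erase i _ (hA' h)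
  have key : (∏ k ∈ Finset.univ.erase i, if k ∈ A then a k else 1 - a k)
      = (∏ j ∈ A, a j) * ∏ j ∈ Finset.univ.erase i \ A, (1 - a j) := by
    rw [Finset.prod_ite]
    congr 1
    · refine Finset.prod_congr ?_ fun _ _ => rfl
      ext k
      simp only [Finset.mem_filter]
      exact ⟨fun h => h.2, fun h => ⟨hA' h, h⟩⟩
    · exact Finset.prod_congr (by ext; simp) fun _ _ => rfl
  rw [bernoulliWeight_insert a i A, bernoulliWeight_of_notMem a hi, key]
  simp only [Finset.insert_idem]
  ring

theorem bernoulliMean_add (a : ι → ℝ) (f g : Finset ι → ℝ) :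
    bernoulliMean a (fun A => f A + g A) = bernoulliMean a f + bernoulliMean a g := by
  simp [bernoulliMean, mul_add, Finset.sum_add_distrib]

theorem bernoulliMean_sub (a : ι → ℝ) (f g : Finset ι → ℝ) :
    bernoulliMean a (fun A => f A - g A) = bernoulliMean a f - bernoulliMean a g := by
  simp [bernoulliMean, mul_sub, Finset.sum_sub_distrib]

theorem bernoulliMean_const_mul (a : ι → ℝ) (c : ℝ) (f : Finset ι → ℝ) :
    bernoulliMean a (fun A => c * f A) = c * bernoulliMean a f := by
  simp only [bernoulliMean, Finset.mul_sum]
  exact Finset.sum_congr rfl fun _ _ => by ring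

theorem bernoulliMean_const (a : ι → ℝ) (c : ℝ) : bernoulliMean a (fun _ => c) = c := by
  rw [bernoulliMean, ← Finset.sum_mul, sum_bernoulliWeight, one_mul]

theorem bernoulliMean_sum {κ : Type*} (s : Finset κ) (a : ι → ℝ) (f : κ → Finset ι → ℝ) :
    bernoulliMean a (fun A => ∑ k ∈ s, f k A) = ∑ k ∈ s, bernoulliMean a (f k) := by
  simp only [bernoulliMean, Finset.mul_sum]
  exact Finset.sum_comm

theorem bernoulliMean_mono {a : ι → ℝ} (h0 : ∀ j, 0 ≤ a j) (h1 : ∀ j, a j ≤ 1)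
    {f g : Finset ι → ℝ} (h : ∀ A, f A ≤ g A) : bernoulliMean a f ≤ bernoulliMean a g :=
  Finset.sum_le_sum fun A _ => mul_le_mul_of_nonneg_left (h A) (bernoulliWeight_nonneg h0 h1 A)

theorem eq_of_bernoulliMean_eq {a : ι → ℝ} (h0 : ∀ j, 0 < a j) (h1 : ∀ j, a j < 1)
    {f g : Finset ι → ℝ} (h : ∀ A, f A ≤ g A) (he : bernoulliMean a f = bernoulliMean a g)
    (A : Finset ι) : f A = g A := by
  have h2 := (Finset.sum_eq_sum_iff_of_le (s := Finset.univ) fun A _ =>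
    mul_le_mul_of_nonneg_left (h A) (bernoulliWeight_pos h0 h1 A).le).1 he A (Finset.mem_univ A)
  exact mul_left_cancel₀ (bernoulliWeight_pos h0 h1 A).ne' h2

omit [Fintype ι] in
theorem resample_mono {a : ι → ℝ} (h0 : ∀ j, 0 ≤ a j) (h1 : ∀ j, a j ≤ 1) (j : ι)
    {f : Finset ι → ℝ} (hf : Monotone f) : Monotone (resample a j f) := fun A B hAB =>
  add_le_add
    (mul_le_mul_of_nonneg_left (hf (Finset.insert_subset_insert j hAB)) (h0 j))
    (mul_le_mul_of_nonneg_left (hf (Finset.erase_subset_erase j hAB)) (by linarith [h1 j]))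

/-- Positive correlation of increasing functions under a product Bernoulli law. -/
theorem bernoulliMean_mul_le {a : ι → ℝ} (h0 : ∀ j, 0 ≤ a j) (h1 : ∀ j, a j ≤ 1)
    {f g : Finset ι → ℝ} (hf : Monotone f) (hg : Monotone g) :
    bernoulliMean a f * bernoulliMean a g ≤ bernoulliMean a (fun A => f A * g A) := by
  -- The FKG inequality needs nonnegative functions. Subtracting the values at `∅`, the minima,
  -- leaves the covariance unchanged.
  have h := fkg (f := fun A => f A - f ∅) (μ := bernoulliWeight a) (g := fun A => g A - g ∅)
    (fun A => bernoulliWeight_nonneg h0 h1 A)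
    (fun A => sub_nonneg.2 (hf (Finset.empty_subset A)))
    (fun A => sub_nonneg.2 (hg (Finset.empty_subset A)))
    (fun A B hAB => sub_le_sub_right (hf hAB) _) (fun A B hAB => sub_le_sub_right (hg hAB) _)
    (fun A B => (bernoulliWeight_mul a A B).le)
  rw [sum_bernoulliWeight, one_mul] at h
  change bernoulliMean a (fun A => f A - f ∅) * bernoulliMean a (fun A => g A - g ∅) ≤
    bernoulliMean a (fun A => (f A - f ∅) * (g A - g ∅)) at h
  have e : bernoulliMean a (fun A => (f A - f ∅) * (g A - g ∅)) =
      bernoulliMean a (fun A => f A * g A) - g ∅ * bernoulliMean a f - f ∅ * bernoulliMean a g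
        + f ∅ * g ∅ := by
    rw [← bernoulliMean_const_mul, ← bernoulliMean_const_mul, ← bernoulliMean_sub,
      ← bernoulliMean_sub, ← bernoulliMean_const a (f ∅ * g ∅), ← bernoulliMean_add]
    congr 1
    funext A
    ring
  rw [e, bernoulliMean_sub, bernoulliMean_sub, bernoulliMean_const, bernoulliMean_const] at h
  nlinarith

omit [Fintype ι] in
theorem insert_erase_eq_insert (j : ι) (A : Finset ι) : insert j (A.erase j) = insert j A := by
  ext k
  by_cases hk : k = j <;> simp [hk]

/-- Resampling is a conditional expectation, hence a self-adjoint projection. -/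
theorem bernoulliMean_mul_resample (a : ι → ℝ) (j : ι) (f h : Finset ι → ℝ) :
    bernoulliMean a (fun A => f A * resample a j h A)
      = bernoulliMean a (fun A => resample a j f A * resample a j h A) := by
  rw [← bernoulliMean_resample a j]
  congr 1
  funext A
  simp only [resample, Finset.insert_idem, Finset.erase_insert_eq_erase, Finset.erase_idem,
    insert_erase_eq_insert]
  ring

/-- The Dirichlet form of the resampling of $j$: given the other coordinates, the covariance of two
functions of one Bernoulli variable is $a_j(1-a_j)$ times the product of their increments. -/
theorem bernoulliMean_mul_sub_resample (a : ι → ℝ) (j : ι) (f h : Finset ι → ℝ) :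
    bernoulliMean a (fun A => f A * (h A - resample a j h A))
      = bernoulliMean a (fun A => a j * (1 - a j) *
          ((f (insert j A) - f (A.erase j)) * (h (insert j A) - h (A.erase j)))) := by
  have e1 : bernoulliMean a (fun A => f A * (h A - resample a j h A)) =
      bernoulliMean a (fun A => f A * h A) - bernoulliMean a (fun A => f A * resample a j h A) := by
    rw [← bernoulliMean_sub]
    simp only [mul_sub]
  rw [e1, bernoulliMean_mul_resample, ← bernoulliMean_resample a j (fun A => f A * h A),
    ← bernoulliMean_sub]
  congr 1
  funext A
  simp only [resample]
  ring

omit [Fintype ι] in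
theorem mul_sub_erase_nonneg {f h : Finset ι → ℝ} (hf : Monotone f) (hh : Monotone h)
    (j : ι) (A : Finset ι) :
    0 ≤ (f (insert j A) - f (A.erase j)) * (h (insert j A) - h (A.erase j)) :=
  have hs : A.erase j ⊆ insert j A := (Finset.erase_subset j A).trans (Finset.subset_insert j A)
  mul_nonneg (sub_nonneg.2 (hf hs)) (sub_nonneg.2 (hh hs))

theorem bernoulliMean_mul_sub_resample_nonneg {a : ι → ℝ} (h0 : ∀ j, 0 ≤ a j)
    (h1 : ∀ j, a j ≤ 1) {f h : Finset ι → ℝ} (hf : Monotone f) (hh : Monotone h) (j : ι) :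
    0 ≤ bernoulliMean a (fun A => f A * (h A - resample a j h A)) := by
  rw [bernoulliMean_mul_sub_resample]
  exact Finset.sum_nonneg fun A _ => mul_nonneg (bernoulliWeight_nonneg h0 h1 A)
    (mul_nonneg (mul_nonneg (h0 j) (by linarith [h1 j])) (mul_sub_erase_nonneg hf hh j A))

/-- Equality case, the source of strictness: all weights are positive and all edge products
nonnegative, so a nonpositive Dirichlet form annihilates each of them. -/
theorem mul_sub_eq_zero_of_bernoulliMean_nonpos {a : ι → ℝ} (h0 : ∀ j, 0 < a j)
    (h1 : ∀ j, a j < 1) {f h : Finset ι → ℝ} (hf : Monotone f) (hh : Monotone h) {j : ι}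
    (he : bernoulliMean a (fun A => f A * (h A - resample a j h A)) ≤ 0) (A : Finset ι) :
    (f (insert j A) - f (A.erase j)) * (h (insert j A) - h (A.erase j)) = 0 := by
  have hp : 0 < a j * (1 - a j) := mul_pos (h0 j) (by linarith [h1 j])
  have h2 : bernoulliMean a (fun _ => (0 : ℝ)) =
      bernoulliMean a (fun A => a j * (1 - a j) *
          ((f (insert j A) - f (A.erase j)) * (h (insert j A) - h (A.erase j)))) := by
    rw [← bernoulliMean_mul_sub_resample, bernoulliMean_const]
    exact le_antisymm (bernoulliMean_mul_sub_resample_nonneg (fun j => (h0 j).le)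
      (fun j => (h1 j).le) hf hh j) he
  have h3 := eq_of_bernoulliMean_eq h0 h1
    (fun A => mul_nonneg hp.le (mul_sub_erase_nonneg hf hh j A)) h2 A
  exact (mul_eq_zero.1 h3.symm).resolve_left hp.ne'

/-- The covariance of two increasing functions dominates the expected conditional covariance given
all coordinates but one. -/
theorem bernoulliMean_mul_sub_resample_le {a : ι → ℝ} (h0 : ∀ j, 0 ≤ a j)
    (h1 : ∀ j, a j ≤ 1) {f h : Finset ι → ℝ} (hf : Monotone f) (hh : Monotone h) (j : ι) :
    bernoulliMean a (fun A => f A * (h A - resample a j h A)) ≤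
      bernoulliMean a (fun A => f A * h A) - bernoulliMean a f * bernoulliMean a h := by
  have h2 := bernoulliMean_mul_le h0 h1 (resample_mono h0 h1 j hf) (resample_mono h0 h1 j hh)
  rw [bernoulliMean_resample, bernoulliMean_resample, ← bernoulliMean_mul_resample] at h2
  have e1 : bernoulliMean a (fun A => f A * (h A - resample a j h A)) =
      bernoulliMean a (fun A => f A * h A) - bernoulliMean a (fun A => f A * resample a j h A) := by
    rw [← bernoulliMean_sub]
    simp only [mul_sub]
  linarith

/-- If `h` is increasing and solves the resolvent-type equation `L h + c = g h`, where `L`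
resamples coordinate `j` at rate `R j`, then `h` increases along some edge along which `g`
decreases, unless `g` is constant. -/
theorem not_monotone_of_resolvent {a R : ι → ℝ} (h0 : ∀ j, 0 ≤ a j) (h1 : ∀ j, a j ≤ 1)
    (hR : ∀ j, 0 ≤ R j) {c : ℝ} (hc : 0 < c) {g h : Finset ι → ℝ} (hh : Monotone h)
    (hh0 : ∀ A, 0 ≤ h A)
    (he : ∀ A, ∑ j, R j * (resample a j h A - h A) + c = g A * h A) {k : ι} {A : Finset ι}
    (hg : g (insert k A) < g A) : h (insert k A) ≠ h A := by
  intro heq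
  -- If `h A` were zero, the left side of the equation would be at least `c`, and the right side
  -- zero.
  have hpos : 0 < h A := by
    refine lt_of_le_of_ne (hh0 A) fun hz => ?_
    have h2 := he A
    rw [← hz, mul_zero] at h2
    have h3 : 0 ≤ ∑ j, R j * (resample a j h A - 0) := Finset.sum_nonneg fun j _ =>
      mul_nonneg (hR j) (by
        rw [sub_zero]
        exact add_nonneg (mul_nonneg (h0 j) (hh0 _)) (mul_nonneg (by linarith [h1 j]) (hh0 _)))
    linarith
  have h2 : ∑ j, R j * (resample a j h A - h A) ≤
      ∑ j, R j * (resample a j h (insert k A) - h (insert k A)) :=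
    Finset.sum_le_sum fun j _ => mul_le_mul_of_nonneg_left
      (by linarith [resample_mono h0 h1 j hh (Finset.subset_insert k A)]) (hR j)
  have h3 := he A
  have h4 := he (insert k A)
  rw [heq] at h4
  rw [heq] at h2
  -- From `A` to `insert k A` the left side does not decrease, while the right side strictly
  -- decreases, since `h A > 0` and `g` drops.
  nlinarith

end ProductBernoulli

/-! ### A fixed point theorem for linear maps -/

open Filter Topology in
/-- A continuous linear self-map of a nonempty compact convex set has a fixed point. -/
theorem exists_mem_eq_of_isCompact_convex {E : Type*} [AddCommGroup E] [Module ℝ E]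
    [TopologicalSpace E] [IsTopologicalAddGroup E] [ContinuousSMul ℝ E] [T2Space E]
    (T : E →ₗ[ℝ] E) (hT : Continuous T) {K : Set E} (hK : IsCompact K) (hconv : Convex ℝ K)
    (hne : K.Nonempty) (hmap : Set.MapsTo T K K) : ∃ x ∈ K, T x = x := by
  obtain ⟨x, hx⟩ := hne
  have hiter : ∀ k, T^[k] x ∈ K := fun k => hmap.iterate k hx
  let ε : ℕ → ℝ := fun m => 1 / ((m : ℝ) + 1)
  have hε : Tendsto ε atTop (𝓝 0) := tendsto_one_div_add_atTop_nhds_zero_nat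
  -- Cesàro averages of an orbit: `T` moves them by a telescoped difference that tends to zero, so
  -- every cluster point is fixed.
  let avg : ℕ → E := fun m => ε m • ∑ k ∈ Finset.range (m + 1), T^[k] x
  have havg : ∀ m, avg m ∈ K := fun m => by
    simp only [avg, Finset.smul_sum]
    refine hconv.sum_mem (fun _ _ => by positivity) ?_ fun k _ => hiter k
    simp only [Finset.sum_const, Finset.card_range, nsmul_eq_mul, ε]
    push_cast
    field_simp
  have hdiff : ∀ m, T (avg m) - avg m = ε m • T^[m + 1] x - ε m • x := fun m => by
    simp only [avg, map_smul, map_sum, ← smul_sub]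
    congr 1
    have h := Finset.sum_range_sub (fun k => T^[k] x) (m + 1)
    rw [Finset.sum_sub_distrib] at h
    simpa only [Function.iterate_succ_apply', Function.iterate_zero, id] using h
  have hlim : Tendsto (fun m => T (avg m) - avg m) atTop (𝓝 0) := by
    simp only [hdiff]
    have hb := hK.isVonNBounded ℝ
    have h1 := hb.smul_tendsto_zero (x := fun m => T^[m + 1] x)
      (Eventually.of_forall fun m => hiter (m + 1)) hε
    have h2 := hb.smul_tendsto_zero (x := fun _ => x) (Eventually.of_forall fun _ => hx) hε
    simpa using h1.sub h2
  -- An ultrafilter replaces a convergent subsequence, as compactness need not be sequential here.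
  obtain ⟨z, hz, hUz⟩ := hK.ultrafilter_le_nhds ((hyperfilter ℕ).map avg)
    (le_principal_iff.2 (Filter.mem_map.2 (Filter.univ_mem' havg)))
  have hUz' : Tendsto avg (hyperfilter ℕ) (𝓝 z) := hUz
  refine ⟨z, hz, ?_⟩
  have h1 : Tendsto (fun m => T (avg m) - avg m) (hyperfilter ℕ) (𝓝 (T z - z)) :=
    ((hT.tendsto z).comp hUz').sub hUz'
  exact sub_eq_zero.1 (tendsto_nhds_unique h1 (hlim.mono_left Nat.hyperfilter_le_atTop))

/-! ### Chains driven by a product chain, and their monotone conditional laws -/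

section Driven

variable {ι : Type*} [DecidableEq ι]

/-- `D` times the operator that removes `j` with probability `w A / D` from the set `A`. -/
def thin (D : ℝ) (w : Finset ι → ℝ) (j : ι) (φ : Finset ι → ℝ) (A : Finset ι) : ℝ :=
  (D - w A) * φ A + w A * φ (A.erase j)

/-- The alternatives excuse a branch of probability zero from landing where `φ` is nonnegative, that
is, from respecting the relation. -/
theorem thin_nonneg {D : ℝ} {w : Finset ι → ℝ} {j : ι} {φ : Finset ι → ℝ} {A : Finset ι}
    (h0 : 0 ≤ w A) (h1 : w A ≤ D) (hA : w A = D ∨ 0 ≤ φ A) (hE : w A = 0 ∨ 0 ≤ φ (A.erase j)) :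
    0 ≤ thin D w j φ A := by
  refine add_nonneg ?_ ?_
  · rcases hA with h | h
    · simp [h]
    · exact mul_nonneg (by linarith) h
  · rcases hE with h | h
    · simp [h]
    · exact mul_nonneg h0 h

/-- A larger set loses `j` at a smaller rate, and staying is better than leaving for an increasing
`φ`. When `j` is not in the smaller set, removal leaves that set unchanged. -/
theorem thin_mono {D : ℝ} {w : Finset ι → ℝ} {j : ι} {φ : Finset ι → ℝ} (hφ : Monotone φ)
    (h0 : ∀ A, 0 ≤ w A) (h1 : ∀ A, w A ≤ D) (hw : ∀ A B, j ∈ A → A ⊆ B → w B ≤ w A) :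
    Monotone (thin D w j φ) := by
  intro A B hAB
  unfold thin
  have hE : φ (A.erase j) ≤ φ (B.erase j) := hφ (Finset.erase_subset_erase j hAB)
  have hB : φ (B.erase j) ≤ φ B := hφ (Finset.erase_subset j B)
  have hA : φ A ≤ φ B := hφ hAB
  by_cases hj : j ∈ A
  · have h2 := hw A B hj hAB
    have h3 : φ (A.erase j) ≤ φ A := hφ (Finset.erase_subset j A)
    nlinarith [h0 A, h1 A, h0 B, h1 B, mul_le_mul_of_nonneg_left hE (h0 B),
      mul_le_mul_of_nonneg_left hA (sub_nonneg.2 (h1 B)),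
      mul_le_mul_of_nonneg_left h3 (sub_nonneg.2 h2)]
  · rw [Finset.erase_eq_of_notMem hj] at hE ⊢
    nlinarith [mul_le_mul_of_nonneg_left hE (h0 B),
      mul_le_mul_of_nonneg_left hA (sub_nonneg.2 (h1 B))]

/-- Indicator function of the sets containing `i`. -/
def occupied (i : ι) (A : Finset ι) : ℝ := if i ∈ A then 1 else 0

/-- Rates of a Markov chain `X` on the subsets of `ι` that is driven by a product chain `Y`:
coordinate `j` of `Y` is resampled at rate `R j` with success probability `a j`; on success `j`
joins `X`, on failure `j` leaves `X` with probability `c j X`. Independently `j` joins `X` at rate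
`u j` and leaves it at rate `d j X`. The relation `rel Y X` is preserved by all transitions. -/
structure DrivenDynamics (ι : Type*) [DecidableEq ι] where
  R : ι → ℝ
  a : ι → ℝ
  u : ι → ℝ
  D : ι → ℝ
  c : ι → Finset ι → ℝ
  d : ι → Finset ι → ℝ
  rel : Finset ι → Finset ι → Prop
  R_nonneg : ∀ j, 0 ≤ R j
  a_pos : ∀ j, 0 < a j
  a_lt_one : ∀ j, a j < 1
  u_nonneg : ∀ j, 0 ≤ u j
  c_nonneg : ∀ j A, 0 ≤ c j A
  c_le_one : ∀ j A, c j A ≤ 1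
  c_antitone : ∀ j A B, j ∈ A → A ⊆ B → c j B ≤ c j A
  d_nonneg : ∀ j A, 0 ≤ d j A
  d_le : ∀ j A, d j A ≤ D j
  d_antitone : ∀ j A B, j ∈ A → A ⊆ B → d j B ≤ d j A
  rel_self : ∀ A, rel A A
  rel_join : ∀ j y A, R j ≠ 0 → j ∈ y → rel (insert j y) A ∨ rel (y.erase j) A →
    rel y (insert j A)
  rel_stay : ∀ j y A, R j ≠ 0 → j ∉ y → rel (insert j y) A ∨ rel (y.erase j) A →
    c j A = 1 ∨ rel y A
  rel_leave : ∀ j y A, R j ≠ 0 → j ∉ y → rel (insert j y) A ∨ rel (y.erase j) A →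
    rel y (A.erase j)
  rel_add : ∀ j y A, u j ≠ 0 → rel y A → rel y (insert j A)
  rel_drop : ∀ j y A, rel y A → d j A = 0 ∨ rel y (A.erase j)

namespace DrivenDynamics

variable (M : DrivenDynamics ι)

/-- Effect on test functions of a resampling of coordinate `j` with outcome `j ∈ y`. -/
def response (j : ι) (y : Finset ι) (φ : Finset ι → ℝ) : Finset ι → ℝ :=
  if j ∈ y then fun A => φ (insert j A) else thin 1 (M.c j) j φ

/-- Action of the transitions of coordinate `j` (with multiplicity) on the conditional
expectations `F y φ` of `φ X` given `Y = y`. -/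
def move (j : ι) :
    (Finset ι → (Finset ι → ℝ) → ℝ) →ₗ[ℝ] Finset ι → (Finset ι → ℝ) → ℝ where
  toFun F y φ :=
    M.R j * (M.a j * F (insert j y) (M.response j y φ) +
      (1 - M.a j) * F (y.erase j) (M.response j y φ)) +
    M.u j * F y (fun A => φ (insert j A)) + F y (thin (M.D j) (M.d j) j φ)
  map_add' F G := by
    funext y φ
    simp only [Pi.add_apply]
    ring
  map_smul' r F := by
    funext y φ
    simp only [Pi.smul_apply, smul_eq_mul, RingHom.id_apply]
    ring

/-- Families of conditional expectations, up to normalization, that are positive, supported in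
`rel` and increasing in the condition. -/
structure IsKernel (F : Finset ι → (Finset ι → ℝ) → ℝ) : Prop where
  map_add : ∀ y φ ψ, F y (φ + ψ) = F y φ + F y ψ
  map_smul : ∀ y (r : ℝ) φ, F y (r • φ) = r * F y φ
  nonneg : ∀ y φ, (∀ A, M.rel y A → 0 ≤ φ A) → 0 ≤ F y φ
  mono : ∀ φ, Monotone φ → Monotone fun y => F y φ

variable {M}

theorem IsKernel.add {F G : Finset ι → (Finset ι → ℝ) → ℝ} (hF : M.IsKernel F)
    (hG : M.IsKernel G) : M.IsKernel (F + G) where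
  map_add y φ ψ := by simp only [Pi.add_apply, hF.map_add, hG.map_add]; ring
  map_smul y r φ := by simp only [Pi.add_apply, hF.map_smul, hG.map_smul]; ring
  nonneg y φ h := add_nonneg (hF.nonneg y φ h) (hG.nonneg y φ h)
  mono φ h := (hF.mono φ h).add (hG.mono φ h)

theorem IsKernel.smul {F : Finset ι → (Finset ι → ℝ) → ℝ} (hF : M.IsKernel F) {r : ℝ}
    (hr : 0 ≤ r) : M.IsKernel (r • F) where
  map_add y φ ψ := by simp only [Pi.smul_apply, smul_eq_mul, hF.map_add]; ring
  map_smul y s φ := by simp only [Pi.smul_apply, smul_eq_mul, hF.map_smul]; ring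
  nonneg y φ h := mul_nonneg hr (hF.nonneg y φ h)
  mono φ h := fun _ _ hy => mul_le_mul_of_nonneg_left (hF.mono φ h hy) hr

theorem IsKernel.sum {s : Finset ι} {F : ι → Finset ι → (Finset ι → ℝ) → ℝ}
    (hF : ∀ j, M.IsKernel (F j)) : M.IsKernel (∑ j ∈ s, F j) := by
  refine Finset.sum_induction _ M.IsKernel (fun _ _ => IsKernel.add) ?_ fun j _ => hF j
  exact ⟨by simp, by simp, by simp, fun _ _ _ _ _ => le_rfl⟩

variable (M) in
theorem response_mono (j : ι) {φ : Finset ι → ℝ} (hφ : Monotone φ) (y : Finset ι) :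
    Monotone (M.response j y φ) := by
  unfold response
  split_ifs
  · exact fun A B h => hφ (Finset.insert_subset_insert j h)
  · exact thin_mono hφ (M.c_nonneg j) (M.c_le_one j) (M.c_antitone j)

variable (M) in
theorem response_le (j : ι) {φ : Finset ι → ℝ} (hφ : Monotone φ) {y z : Finset ι} (h : y ⊆ z)
    (A : Finset ι) : M.response j y φ A ≤ M.response j z φ A := by
  unfold response
  by_cases hy : j ∈ y
  · simp [hy, h hy]
  · by_cases hz : j ∈ z
    · simp only [hy, hz, if_true, if_false, thin]
      have h1 : φ A ≤ φ (insert j A) := hφ (Finset.subset_insert j A)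
      have h2 : φ (A.erase j) ≤ φ (insert j A) :=
        hφ ((Finset.erase_subset j A).trans (Finset.subset_insert j A))
      nlinarith [mul_le_mul_of_nonneg_left h1 (sub_nonneg.2 (M.c_le_one j A)),
        mul_le_mul_of_nonneg_left h2 (M.c_nonneg j A)]
    · simp [hy, hz]

theorem response_nonneg {j : ι} {y : Finset ι} {φ : Finset ι → ℝ}
    (hφ : ∀ A, M.rel y A → 0 ≤ φ A) (hR : M.R j ≠ 0) {A : Finset ι}
    (hA : M.rel (insert j y) A ∨ M.rel (y.erase j) A) : 0 ≤ M.response j y φ A := by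
  unfold response
  split_ifs with hj
  · exact hφ _ (M.rel_join j y A hR hj hA)
  · exact thin_nonneg (M.c_nonneg j A) (M.c_le_one j A)
      ((M.rel_stay j y A hR hj hA).imp_right (hφ _)) (Or.inr (hφ _ (M.rel_leave j y A hR hj hA)))

theorem IsKernel.le {F : Finset ι → (Finset ι → ℝ) → ℝ} (hF : M.IsKernel F) {y : Finset ι}
    {φ ψ : Finset ι → ℝ} (h : ∀ A, M.rel y A → φ A ≤ ψ A) : F y φ ≤ F y ψ := by
  have h1 : ψ = φ + (ψ - φ) := by abel
  rw [h1, hF.map_add]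
  linarith [hF.nonneg y (ψ - φ) fun A hA => sub_nonneg.2 (h A hA)]

theorem response_add (j : ι) (y : Finset ι) (φ ψ : Finset ι → ℝ) :
    M.response j y (φ + ψ) = M.response j y φ + M.response j y ψ := by
  unfold response
  split_ifs <;> funext A <;> simp only [thin, Pi.add_apply] <;>
    ring

theorem response_smul (j : ι) (y : Finset ι) (r : ℝ) (φ : Finset ι → ℝ) :
    M.response j y (r • φ) = r • M.response j y φ := by
  unfold response
  split_ifs
  · rfl
  · funext A
    simp only [thin, Pi.smul_apply, smul_eq_mul]
    ring

/-- By reversibility, the state of `Y` before a resampling that ended in `y` is `y` with coordinate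
`j` resampled, which increases with `y`. The response of `X` to the outcome preserves increasing
functions and also increases with `y`; both facts together give monotonicity. -/
theorem IsKernel.move {F : Finset ι → (Finset ι → ℝ) → ℝ} (hF : M.IsKernel F) (j : ι) :
    M.IsKernel (M.move j F) where
  map_add y φ ψ := by
    have h1 : thin (M.D j) (M.d j) j (φ + ψ)
        = thin (M.D j) (M.d j) j φ + thin (M.D j) (M.d j) j ψ := by
      funext A
      simp only [thin, Pi.add_apply]
      ring
    have h2 : (fun A => (φ + ψ) (insert j A))
        = (fun A => φ (insert j A)) + fun A => ψ (insert j A) := rfl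
    change _ * (_ * F _ _ + _ * F _ _) + _ * F y (fun A => (φ + ψ) (insert j A)) + F y _ =
      _ * (_ * F _ _ + _ * F _ _) + _ * F y _ + F y _ +
      (_ * (_ * F _ _ + _ * F _ _) + _ * F y _ + F y _)
    rw [h1, h2, response_add]
    simp only [hF.map_add]
    ring
  map_smul y r φ := by
    have h1 : thin (M.D j) (M.d j) j (r • φ) = r • thin (M.D j) (M.d j) j φ := by
      funext A
      simp only [thin, Pi.smul_apply, smul_eq_mul]
      ring
    have h2 : (fun A => (r • φ) (insert j A)) = r • fun A => φ (insert j A) := rfl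
    change _ * (_ * F _ _ + _ * F _ _) + _ * F y (fun A => (r • φ) (insert j A)) + F y _ =
      r * (_ * (_ * F _ _ + _ * F _ _) + _ * F y _ + F y _)
    rw [h1, h2, response_smul]
    simp only [hF.map_smul]
    ring
  nonneg y φ h := by
    refine add_nonneg (add_nonneg ?_ ?_) ?_
    · by_cases hR : M.R j = 0
      · rw [hR, zero_mul]
      · exact mul_nonneg (M.R_nonneg j) (add_nonneg
          (mul_nonneg (M.a_pos j).le
            (hF.nonneg _ _ fun A hA => response_nonneg h hR (Or.inl hA)))
          (mul_nonneg (by linarith [M.a_lt_one j])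
            (hF.nonneg _ _ fun A hA => response_nonneg h hR (Or.inr hA))))
    · by_cases hu : M.u j = 0
      · rw [hu, zero_mul]
      · exact mul_nonneg (M.u_nonneg j)
          (hF.nonneg _ _ fun A hA => h _ (M.rel_add j y A hu hA))
    · exact hF.nonneg _ _ fun A hA => thin_nonneg (M.d_nonneg j A) (M.d_le j A)
        (Or.inr (h A hA)) ((M.rel_drop j y A hA).imp_right (h _))
  mono φ h := by
    intro y z hyz
    have key : ∀ y' z' : Finset ι, y' ⊆ z' →
        F y' (M.response j y φ) ≤ F z' (M.response j z φ) := fun y' z' h' =>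
      (hF.mono _ (M.response_mono j h y) h').trans (hF.le fun A _ => M.response_le j h hyz A)
    refine add_le_add (add_le_add ?_ ?_) ?_
    · exact mul_le_mul_of_nonneg_left (add_le_add
        (mul_le_mul_of_nonneg_left (key _ _ (Finset.insert_subset_insert j hyz)) (M.a_pos j).le)
        (mul_le_mul_of_nonneg_left (key _ _ (Finset.erase_subset_erase j hyz))
          (by linarith [M.a_lt_one j]))) (M.R_nonneg j)
    · exact mul_le_mul_of_nonneg_left
        (hF.mono _ (fun A B hAB => h (Finset.insert_subset_insert j hAB)) hyz) (M.u_nonneg j)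
    · exact hF.mono _ (thin_mono h (M.d_nonneg j) (M.d_le j) (M.d_antitone j)) hyz

theorem IsKernel.map_const_mul {F : Finset ι → (Finset ι → ℝ) → ℝ} (hF : M.IsKernel F)
    (y : Finset ι) (r : ℝ) (φ : Finset ι → ℝ) : F y (fun A => r * φ A) = r * F y φ :=
  hF.map_smul y r φ

theorem IsKernel.map_const {F : Finset ι → (Finset ι → ℝ) → ℝ} (hF : M.IsKernel F)
    (h1 : ∀ y, F y 1 = 1) (y : Finset ι) (r : ℝ) : F y (fun _ => r) = r := by
  have h := hF.map_smul y r 1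
  rw [h1, mul_one] at h
  have e : (fun _ : Finset ι => r) = r • 1 := by
    funext A
    simp
  rw [e, h]

/-- The conditional expectation given `Y = y` as a linear functional. -/
def IsKernel.toLinearMap {F : Finset ι → (Finset ι → ℝ) → ℝ} (hF : M.IsKernel F)
    (y : Finset ι) : (Finset ι → ℝ) →ₗ[ℝ] ℝ where
  toFun := F y
  map_add' := hF.map_add y
  map_smul' := hF.map_smul y

variable [Fintype ι]

variable (M) in
/-- Total rate of the uniformized dynamics. -/
def totalRate : ℝ := 1 + ∑ j, (M.R j + M.u j + M.D j)

variable (M) in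
theorem totalRate_pos : 0 < M.totalRate := by
  have h : 0 ≤ ∑ j, (M.R j + M.u j + M.D j) := Finset.sum_nonneg fun j _ => by
    linarith [M.R_nonneg j, M.u_nonneg j, M.d_nonneg j ∅, M.d_le j ∅]
  unfold totalRate
  linarith

omit [Fintype ι] in
theorem move_one {F : Finset ι → (Finset ι → ℝ) → ℝ} (hF : M.IsKernel F)
    (h1 : ∀ y, F y 1 = 1) (j : ι) (y : Finset ι) :
    M.move j F y 1 = M.R j + M.u j + M.D j := by
  have e1 : M.response j y 1 = 1 := by
    unfold response
    split_ifs <;> funext A <;> simp [thin]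
  have e2 : thin (M.D j) (M.d j) j (1 : Finset ι → ℝ) = fun _ => M.D j := by
    funext A
    simp [thin]
  have e3 : (fun A : Finset ι => (1 : Finset ι → ℝ) (insert j A)) = 1 := rfl
  change M.R j * (M.a j * F _ _ + _ * F _ _) + _ * F y (fun A => (1 : Finset ι → ℝ) (insert j A))
    + F y _ = _
  rw [e1, e2, e3, hF.map_const h1]
  simp only [h1]
  ring

variable (M) in
/-- Stationary family of conditional laws of `X` given `Y`. -/
theorem exists_stationary_kernel : ∃ F, M.IsKernel F ∧ (∀ y, F y 1 = 1) ∧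
    ∀ y φ, ∑ j, M.move j F y φ = (∑ j, (M.R j + M.u j + M.D j)) * F y φ := by
  have hW := M.totalRate_pos
  -- Uniformization. The added identity keeps the normalizing rate positive, and fixed points of `T`
  -- are the stationary families.
  let T : (Finset ι → (Finset ι → ℝ) → ℝ) →ₗ[ℝ] Finset ι → (Finset ι → ℝ) → ℝ :=
    M.totalRate⁻¹ • (LinearMap.id + ∑ j, M.move j)
  have hTapp : ∀ F, T F = M.totalRate⁻¹ • (F + ∑ j, M.move j F) := fun F => by
    simp [T, LinearMap.sum_apply]
  let K : Set (Finset ι → (Finset ι → ℝ) → ℝ) := {F | M.IsKernel F ∧ ∀ y, F y 1 = 1}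
  have hcont : Continuous T := by
    have h : ∀ j, Continuous (M.move j) := fun j => by
      refine continuous_pi fun y => continuous_pi fun φ => ?_
      change Continuous fun F : Finset ι → (Finset ι → ℝ) → ℝ =>
        M.R j * (M.a j * F (insert j y) (M.response j y φ) +
          (1 - M.a j) * F (y.erase j) (M.response j y φ)) +
        M.u j * F y (fun A => φ (insert j A)) + F y (thin (M.D j) (M.d j) j φ)
      fun_prop
    have h2 : ⇑T = fun F => M.totalRate⁻¹ • (F + ∑ j, M.move j F) := funext hTapp
    rw [h2]
    fun_prop
  have hev : ∀ y φ, Continuous fun F : Finset ι → (Finset ι → ℝ) → ℝ => F y φ := fun y φ => by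
    fun_prop
  have hclosed : IsClosed K := by
    have h2 : K = (⋂ y, ⋂ φ, ⋂ ψ, {F | F y (φ + ψ) = F y φ + F y ψ}) ∩
        (⋂ y, ⋂ r : ℝ, ⋂ φ, {F | F y (r • φ) = r * F y φ}) ∩
        (⋂ y, ⋂ φ, ⋂ (_ : ∀ A, M.rel y A → 0 ≤ φ A), {F | 0 ≤ F y φ}) ∩
        (⋂ φ : Finset ι → ℝ, ⋂ (_ : Monotone φ), ⋂ y, ⋂ z, ⋂ (_ : y ≤ z),
          {F | F y φ ≤ F z φ}) ∩
        ⋂ y, {F | F y 1 = 1} := by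
      ext F
      simp only [Set.mem_inter_iff, Set.mem_iInter, Set.mem_ofPred_eq, K]
      constructor
      · rintro ⟨⟨h1, h2, h3, h4⟩, h5⟩
        exact ⟨⟨⟨⟨h1, h2⟩, h3⟩, fun φ hφ y z h => h4 φ hφ h⟩, h5⟩
      · rintro ⟨⟨⟨⟨h1, h2⟩, h3⟩, h4⟩, h5⟩
        exact ⟨⟨h1, h2, h3, fun φ hφ y z h => h4 φ hφ y z h⟩, h5⟩
    rw [h2]
    refine IsClosed.inter (IsClosed.inter (IsClosed.inter (IsClosed.inter ?_ ?_) ?_) ?_) ?_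
    · exact isClosed_iInter fun y => isClosed_iInter fun φ => isClosed_iInter fun ψ =>
        isClosed_eq (hev _ _) ((hev _ _).add (hev _ _))
    · exact isClosed_iInter fun y => isClosed_iInter fun r => isClosed_iInter fun φ =>
        isClosed_eq (hev _ _) (continuous_const.mul (hev _ _))
    · exact isClosed_iInter fun y => isClosed_iInter fun φ => isClosed_iInter fun _ =>
        isClosed_le continuous_const (hev _ _)
    · exact isClosed_iInter fun φ => isClosed_iInter fun _ => isClosed_iInter fun y =>
        isClosed_iInter fun z => isClosed_iInter fun _ => isClosed_le (hev _ _) (hev _ _)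
    · exact isClosed_iInter fun y => isClosed_eq (hev _ _) continuous_const
  -- Positivity and normalization give $|F_y(\varphi)|\le\|\varphi\|$, so Tychonoff's theorem
  -- applies in the topology of pointwise convergence.
  have hK : IsCompact K := by
    refine IsCompact.of_isClosed_subset
      (isCompact_univ_pi fun _ : Finset ι => isCompact_univ_pi fun φ : Finset ι → ℝ =>
        isCompact_Icc (a := -‖φ‖) (b := ‖φ‖)) hclosed ?_
    rintro F ⟨hF, h1⟩ y - φ -
    have hb : ∀ A, |φ A| ≤ ‖φ‖ := fun A => norm_le_pi_norm φ A
    constructor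
    · rw [← hF.map_const h1 y (-‖φ‖)]
      exact hF.le fun A _ => (abs_le.1 (hb A)).1
    · rw [← hF.map_const h1 y ‖φ‖]
      exact hF.le fun A _ => (abs_le.1 (hb A)).2
  have hconv : Convex ℝ K := by
    rintro F ⟨hF, hF1⟩ G ⟨hG, hG1⟩ s t hs ht hst
    refine ⟨(hF.smul hs).add (hG.smul ht), fun y => ?_⟩
    simp [hF1, hG1, hst]
  -- The kernel of the coupling $X=Y$.
  have hne : K.Nonempty := ⟨fun y φ => φ y, ⟨fun _ _ _ => rfl, fun _ _ _ => rfl,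
    fun y φ h => h y (M.rel_self y), fun φ h => h⟩, fun _ => rfl⟩
  have hmap : Set.MapsTo T K K := by
    rintro F ⟨hF, h1⟩
    rw [hTapp]
    refine ⟨(hF.add (IsKernel.sum fun j => hF.move j)).smul (inv_nonneg.2 hW.le), fun y => ?_⟩
    simp only [Pi.smul_apply, Pi.add_apply, Finset.sum_apply, smul_eq_mul, h1, move_one hF h1]
    exact inv_mul_cancel₀ hW.ne'
  obtain ⟨F, ⟨hF, h1⟩, hfix⟩ := exists_mem_eq_of_isCompact_convex T hcont hK hconv hne hmap
  refine ⟨F, hF, h1, fun y φ => ?_⟩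
  rw [hTapp, inv_smul_eq_iff₀ hW.ne'] at hfix
  have h2 := congrFun (congrFun hfix y) φ
  simp only [Pi.smul_apply, Pi.add_apply, Finset.sum_apply, smul_eq_mul, totalRate] at h2
  linarith

/-- Mean of a resampling step. -/
theorem bernoulliMean_resample_response (F : Finset ι → (Finset ι → ℝ) → ℝ) (j : ι)
    (φ : Finset ι → ℝ) :
    bernoulliMean M.a (fun y => M.a j * F (insert j y) (M.response j y φ) +
      (1 - M.a j) * F (y.erase j) (M.response j y φ)) =
    M.a j * bernoulliMean M.a (fun y => F y fun A => φ (insert j A)) +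
      (1 - M.a j) * bernoulliMean M.a (fun y => F y (thin 1 (M.c j) j φ)) := by
  rw [← bernoulliMean_resample M.a j, ← bernoulliMean_resample M.a j (fun y => F y _),
    ← bernoulliMean_resample M.a j (fun y => F y (thin _ _ _ _)), ← bernoulliMean_const_mul,
    ← bernoulliMean_const_mul, ← bernoulliMean_add]
  congr 1
  funext y
  simp only [resample, response, Finset.insert_idem, Finset.erase_insert_eq_erase,
    Finset.erase_idem, insert_erase_eq_insert, Finset.mem_insert_self, if_true,
    Finset.notMem_erase, if_false]

/-- Generator equation for the marginal law of `X`. -/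
theorem bernoulliMean_stationary {F : Finset ι → (Finset ι → ℝ) → ℝ} (hF : M.IsKernel F)
    (hst : ∀ y φ, ∑ j, M.move j F y φ = (∑ j, (M.R j + M.u j + M.D j)) * F y φ)
    (φ : Finset ι → ℝ) :
    bernoulliMean M.a (fun y => F y fun A => ∑ j, ((M.R j * M.a j + M.u j) * (φ (insert j A) - φ A)
      + (M.R j * (1 - M.a j) * M.c j A + M.d j A) * (φ (A.erase j) - φ A))) = 0 := by
  have hlin : ∀ y, (F y fun A => ∑ j, ((M.R j * M.a j + M.u j) * (φ (insert j A) - φ A)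
      + (M.R j * (1 - M.a j) * M.c j A + M.d j A) * (φ (A.erase j) - φ A))) =
      ∑ j, ((M.R j * M.a j + M.u j) * F y (fun A => φ (insert j A)) +
        M.R j * (1 - M.a j) * F y (thin 1 (M.c j) j φ) + F y (thin (M.D j) (M.d j) j φ) -
        (M.R j + M.u j + M.D j) * F y φ) := fun y => by
    have e : (fun A => ∑ j, ((M.R j * M.a j + M.u j) * (φ (insert j A) - φ A)
        + (M.R j * (1 - M.a j) * M.c j A + M.d j A) * (φ (A.erase j) - φ A))) =
        ∑ j, ((M.R j * M.a j + M.u j) • (fun A => φ (insert j A)) +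
          (M.R j * (1 - M.a j)) • thin 1 (M.c j) j φ + thin (M.D j) (M.d j) j φ -
          (M.R j + M.u j + M.D j) • φ) := by
      funext A
      rw [Finset.sum_apply]
      refine Finset.sum_congr rfl fun j _ => ?_
      simp only [Pi.add_apply, Pi.sub_apply, Pi.smul_apply, smul_eq_mul, thin]
      ring
    rw [e]
    change hF.toLinearMap y _ = _
    simp only [map_sum, map_add, map_sub, map_smul, smul_eq_mul]
    rfl
  have hmove : ∀ j, bernoulliMean M.a (fun y => M.move j F y φ) =
      bernoulliMean M.a fun y => (M.R j * M.a j + M.u j) * F y (fun A => φ (insert j A)) +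
        M.R j * (1 - M.a j) * F y (thin 1 (M.c j) j φ) + F y (thin (M.D j) (M.d j) j φ) := by
    intro j
    change bernoulliMean M.a (fun y => M.R j * (M.a j * F (insert j y) (M.response j y φ) +
      (1 - M.a j) * F (y.erase j) (M.response j y φ)) +
      M.u j * F y (fun A => φ (insert j A)) + F y (thin (M.D j) (M.d j) j φ)) = _
    rw [bernoulliMean_add, bernoulliMean_add, bernoulliMean_const_mul,
      bernoulliMean_resample_response]
    simp only [bernoulliMean_add, bernoulliMean_const_mul]
    ring
  simp only [hlin, Finset.sum_sub_distrib, ← Finset.sum_mul]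
  rw [bernoulliMean_sub, bernoulliMean_sum]
  simp only [← hmove]
  rw [← bernoulliMean_sum, sub_eq_zero]
  simp only [hst]

/-- Equation for the probability that `i ∈ X` given `Y = y`, for a coordinate `i` that is not
driven by `Y`. -/
theorem occupation_equation {F : Finset ι → (Finset ι → ℝ) → ℝ} (hF : M.IsKernel F)
    (h1 : ∀ y, F y 1 = 1)
    (hst : ∀ y φ, ∑ j, M.move j F y φ = (∑ j, (M.R j + M.u j + M.D j)) * F y φ)
    {i : ι} (hi : M.R i = 0) (y : Finset ι) :
    ∑ j, M.R j * (resample M.a j (fun z => F z (occupied i)) y - F y (occupied i)) +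
      M.u i * (1 - F y (occupied i)) = F y (fun A => M.d i A * occupied i A) := by
  have hne : ∀ j, j ≠ i → M.move j F y (occupied i) - (M.R j + M.u j + M.D j) * F y (occupied i) =
      M.R j * (resample M.a j (fun z => F z (occupied i)) y - F y (occupied i)) := by
    intro j hj
    have e1 : (fun A => occupied i (insert j A)) = occupied i := by
      funext A
      simp [occupied, hj.symm]
    have e2 : ∀ A, occupied i (A.erase j) = occupied i A := fun A => by
      simp [occupied, hj.symm]
    have e3 : ∀ D w, thin D w j (occupied i) = D • occupied i := fun D w => by
      funext A
      simp only [thin, e2, Pi.smul_apply, smul_eq_mul]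
      ring
    have e4 : M.response j y (occupied i) = occupied i := by
      unfold response
      split_ifs
      · exact e1
      · rw [e3, one_smul]
    change M.R j * (M.a j * F _ (M.response j y (occupied i)) +
      _ * F _ (M.response j y (occupied i))) + _ * F y (fun A => occupied i (insert j A)) +
      F y (thin _ _ j (occupied i)) - _ = _
    rw [e1, e3, e4, hF.map_smul, resample]
    ring
  have heq : M.move i F y (occupied i) - (M.R i + M.u i + M.D i) * F y (occupied i) =
      M.R i * (resample M.a i (fun z => F z (occupied i)) y - F y (occupied i)) +
      (M.u i * (1 - F y (occupied i)) - F y (fun A => M.d i A * occupied i A)) := by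
    have e1 : (fun A => occupied i (insert i A)) = 1 := by
      funext A
      simp [occupied]
    have e2 : thin (M.D i) (M.d i) i (occupied i) =
        M.D i • occupied i + (-1 : ℝ) • fun A => M.d i A * occupied i A := by
      funext A
      simp only [thin, occupied, Pi.add_apply, Pi.smul_apply, smul_eq_mul, Finset.notMem_erase,
        if_false]
      ring
    change M.R i * _ + _ * F y (fun A => occupied i (insert i A)) +
      F y (thin _ _ i (occupied i)) - _ = _
    rw [e1, e2, hF.map_add, hF.map_smul, hF.map_smul, h1, hi]
    ring
  have h := hst y (occupied i)
  rw [Finset.sum_mul, ← sub_eq_zero, ← Finset.sum_sub_distrib,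
    ← Finset.add_sum_erase _ _ (Finset.mem_univ i), heq,
    Finset.sum_congr rfl fun j hj => hne j (Finset.ne_of_mem_erase hj)] at h
  rw [← Finset.add_sum_erase _ _ (Finset.mem_univ i)]
  linarith

omit [Fintype ι] in
theorem occupied_mono (i : ι) : Monotone (occupied i) := fun A B h => by
  unfold occupied
  split_ifs with hA hB
  · exact le_rfl
  · exact absurd (h hA) hB
  · exact zero_le_one
  · exact le_rfl

end DrivenDynamics

end Driven

/-! ### The lumped chain: generator, irreducibility and uniqueness -/

namespace BTSNetwork

variable {n : ℕ} {S : BTSNetwork n}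

theorem rate_antitone (S : BTSNetwork n) {i : Fin n} {A B : Finset (Fin n)} (hi : i ∈ A)
    (hAB : A ⊆ B) : S.rate i B ≤ S.rate i A := by
  refine Finset.sum_le_sum fun C _ => mul_le_mul_of_nonneg_right ?_ (S.band_nonneg C)
  by_cases hC : i ∈ C
  · exact S.eff_antitone i _ _ (Finset.mem_inter.2 ⟨hC, hi⟩) (Finset.inter_subset_inter_left hAB)
  · rw [S.eff_inactive i _ fun h => hC (Finset.mem_inter.1 h).1]
    exact S.eff_nonneg i _

theorem Stable.arr_lt_rate (hS : S.Stable) {i : Fin n} {A : Finset (Fin n)} (hi : i ∈ A) :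
    S.arr i < S.rate i A :=
  (hS i).trans_le (S.rate_antitone hi (Finset.subset_univ A))

/-- Rate at which BTS `i` becomes inactive when the set of active BTSs is `A`. -/
def downRate (S : BTSNetwork n) (i : Fin n) (A : Finset (Fin n)) : ℝ :=
  if i ∈ A then S.rate i A - S.arr i else 0

theorem lumpedRate_nonneg (hS : S.Stable) (A B : Finset (Fin n)) : 0 ≤ S.lumpedRate A B := by
  refine add_nonneg (Finset.sum_nonneg fun i _ => ?_) (Finset.sum_nonneg fun i _ => ?_)
  · split_ifs
    · exact (S.arr_pos i).le
    · exact le_rfl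
  · split_ifs with h
    · exact (sub_pos.2 (hS.arr_lt_rate (by rw [h.2]; exact Finset.mem_insert_self i B))).le
    · exact le_rfl

theorem lumpedRate_insert_pos (hS : S.Stable) {i : Fin n} {A : Finset (Fin n)} (hi : i ∉ A) :
    0 < S.lumpedRate A (insert i A) := by
  refine add_pos_of_pos_of_nonneg ?_ (Finset.sum_nonneg fun j _ => ?_)
  · refine Finset.sum_pos' (fun j _ => ?_) ⟨i, Finset.mem_univ i, ?_⟩
    · split_ifs
      · exact (S.arr_pos j).le
      · exact le_rfl
    · rw [if_pos ⟨hi, rfl⟩]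
      exact S.arr_pos i
  · split_ifs with h
    · exact (sub_pos.2 (hS.arr_lt_rate
        (by rw [h.2]; exact Finset.mem_insert_self j _))).le
    · exact le_rfl

theorem lumpedRate_erase_pos (hS : S.Stable) {i : Fin n} {A : Finset (Fin n)} (hi : i ∉ A) :
    0 < S.lumpedRate (insert i A) A := by
  refine add_pos_of_nonneg_of_pos (Finset.sum_nonneg fun j _ => ?_) ?_
  · split_ifs
    · exact (S.arr_pos j).le
    · exact le_rfl
  · refine Finset.sum_pos' (fun j _ => ?_) ⟨i, Finset.mem_univ i, ?_⟩
    · split_ifs with h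
      · exact (sub_pos.2 (hS.arr_lt_rate
          (by rw [h.2]; exact Finset.mem_insert_self j _))).le
      · exact le_rfl
    · rw [if_pos ⟨hi, rfl⟩]
      exact sub_pos.2 (hS.arr_lt_rate (Finset.mem_insert_self i A))

theorem lumpedGenerator_mulVec (S : BTSNetwork n) (φ : Finset (Fin n) → ℝ)
    (A : Finset (Fin n)) :
    S.lumpedGenerator.mulVec φ A = ∑ i, (S.arr i * (φ (insert i A) - φ A) +
      S.downRate i A * (φ (A.erase i) - φ A)) := by
  have h1 : S.lumpedGenerator.mulVec φ A = ∑ B, S.lumpedRate A B * (φ B - φ A) := by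
    have e : ∀ B ∈ Finset.univ.erase A, S.lumpedGenerator A B = S.lumpedRate A B :=
      fun B hB => if_neg (Finset.ne_of_mem_erase hB).symm
    rw [Matrix.mulVec, dotProduct, ← Finset.add_sum_erase _ _ (Finset.mem_univ A),
      ← Finset.add_sum_erase (Finset.univ) (fun B => S.lumpedRate A B * (φ B - φ A))
        (Finset.mem_univ A), Finset.sum_congr rfl fun B hB => by rw [e B hB]]
    simp only [lumpedGenerator, if_true, sub_self, mul_zero, zero_add, mul_sub,
      Finset.sum_sub_distrib, ← Finset.sum_mul]
    ring
  rw [h1]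
  simp only [lumpedRate, add_mul, Finset.sum_add_distrib, Finset.sum_mul]
  congr 1
  · rw [Finset.sum_comm]
    refine Finset.sum_congr rfl fun i _ => ?_
    by_cases hi : i ∈ A
    · simp [hi]
    · simp [hi]
  · rw [Finset.sum_comm]
    refine Finset.sum_congr rfl fun i _ => ?_
    have hiff : ∀ B, (i ∉ B ∧ A = insert i B) ↔ (i ∈ A ∧ B = A.erase i) := fun B => by
      constructor
      · rintro ⟨hB, rfl⟩
        exact ⟨Finset.mem_insert_self i B, (Finset.erase_insert hB).symm⟩
      · rintro ⟨hA, rfl⟩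
        exact ⟨Finset.notMem_erase i A, (Finset.insert_erase hA).symm⟩
    simp only [hiff, downRate]
    by_cases hi : i ∈ A
    · simp [hi]
    · simp [hi]

theorem vecMul_lumpedGenerator_eq_zero_iff (S : BTSNetwork n) (p : Finset (Fin n) → ℝ) :
    Matrix.vecMul p S.lumpedGenerator = 0 ↔
      ∀ φ : Finset (Fin n) → ℝ, ∑ A, p A * ∑ i, (S.arr i * (φ (insert i A) - φ A) +
        S.downRate i A * (φ (A.erase i) - φ A)) = 0 := by
  have h : ∀ φ : Finset (Fin n) → ℝ, ∑ A, p A * ∑ i, (S.arr i * (φ (insert i A) - φ A) +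
        S.downRate i A * (φ (A.erase i) - φ A)) = Matrix.vecMul p S.lumpedGenerator ⬝ᵥ φ := by
    intro φ
    rw [← Matrix.dotProduct_mulVec]
    simp only [← lumpedGenerator_mulVec]
    rfl
  simp only [h]
  refine ⟨fun h0 φ => by rw [h0, zero_dotProduct], fun h0 => ?_⟩
  exact dotProduct_eq_zero _ h0

/-- Irreducibility: by the balance equation, a zero at a state forces zeros at all states that can
jump to it. Zeros thus propagate from `A` down to `∅`, and from there up to every set. -/
theorem eq_zero_of_vecMul_eq_zero (hS : S.Stable) {v : Finset (Fin n) → ℝ} (h0 : ∀ A, 0 ≤ v A)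
    (hv : Matrix.vecMul v S.lumpedGenerator = 0) {A : Finset (Fin n)} (hA : v A = 0) :
    ∀ B, v B = 0 := by
  have hnb : ∀ B C, v C = 0 → 0 < S.lumpedRate B C → v B = 0 := by
    intro B C hC hr
    have h1 : ∑ D, v D * S.lumpedGenerator D C = 0 := congrFun hv C
    have h2 : ∀ D ∈ Finset.univ, 0 ≤ v D * S.lumpedGenerator D C := fun D _ => by
      by_cases hD : D = C
      · rw [hD, hC, zero_mul]
      · rw [lumpedGenerator, if_neg hD]
        exact mul_nonneg (h0 D) (lumpedRate_nonneg hS D C)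
    have h3 := (Finset.sum_eq_zero_iff_of_nonneg h2).1 h1 B (Finset.mem_univ B)
    by_cases hB : B = C
    · rw [hB, hC]
    · rw [lumpedGenerator, if_neg hB] at h3
      exact (mul_eq_zero.1 h3).resolve_right hr.ne'
  have hempty : v ∅ = 0 := by
    clear hv
    induction A using Finset.induction_on with
    | empty => exact hA
    | insert i A hi ih => exact ih (hnb _ _ hA (lumpedRate_insert_pos hS hi))
  intro B
  induction B using Finset.induction_on with
  | empty => exact hempty
  | insert i B hi ih => exact hnb _ _ ih (lumpedRate_erase_pos hS hi)

theorem IsStationary.pos (hS : S.Stable) {p : Finset (Fin n) → ℝ} (hp : S.IsStationary p)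
    (A : Finset (Fin n)) : 0 < p A := by
  refine lt_of_le_of_ne (hp.1 A) fun h => ?_
  have h1 := hp.2.1
  rw [Finset.sum_congr rfl fun B _ => eq_zero_of_vecMul_eq_zero hS hp.1 hp.2.2 h.symm B] at h1
  simp at h1

/-- Subtracting from `p` the multiple of `q` given by the least ratio leaves a nonnegative invariant
vector with a zero, which must vanish. -/
theorem IsStationary.eq (hS : S.Stable) {p q : Finset (Fin n) → ℝ} (hp : S.IsStationary p)
    (hq : S.IsStationary q) : p = q := by
  obtain ⟨A, -, hA⟩ := Finset.exists_min_image Finset.univ (fun A => p A / q A)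
    Finset.univ_nonempty
  have hle : ∀ B, 0 ≤ (p - (p A / q A) • q) B := fun B => by
    have h := (le_div_iff₀ (hq.pos hS B)).1 (hA B (Finset.mem_univ B))
    simpa using h
  have hz : (p - (p A / q A) • q) A = 0 := by
    have h := (hq.pos hS A).ne'
    simp only [Pi.sub_apply, Pi.smul_apply, smul_eq_mul]
    field_simp
    ring
  have hv : Matrix.vecMul (p - (p A / q A) • q) S.lumpedGenerator = 0 := by
    rw [Matrix.sub_vecMul, Matrix.smul_vecMul, hp.2.2, hq.2.2, smul_zero, sub_zero]
  have h1 : ∀ B, p B = p A / q A * q B := fun B =>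
    sub_eq_zero.1 (eq_zero_of_vecMul_eq_zero hS hle hv hz B)
  have h2 := hp.2.1
  rw [Finset.sum_congr rfl fun B _ => h1 B, ← Finset.mul_sum, hq.2.1, mul_one] at h2
  funext B
  rw [h1 B, h2, one_mul]

end BTSNetwork

/-! ### Mean queue lengths in the modified system -/

theorem hasSum_mul_of_nonneg {α β : Type*} {f : α → ℝ} {g : β → ℝ} {s t : ℝ} (hf : HasSum f s)
    (hg : HasSum g t) (hf0 : ∀ x, 0 ≤ f x) (hg0 : ∀ y, 0 ≤ g y) :
    HasSum (fun x : α × β => f x.1 * g x.2) (s * t) :=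
  hf.mul hg (hf.summable.mul_of_nonneg hg.summable hf0 hg0)

theorem hasSum_fin_prod {n : ℕ} {f : Fin n → ℕ → ℝ} {s : Fin n → ℝ} (h0 : ∀ j l, 0 ≤ f j l)
    (hf : ∀ j, HasSum (f j) (s j)) :
    HasSum (fun l : Fin n → ℕ => ∏ j, f j (l j)) (∏ j, s j) := by
  induction n with
  | zero => simp
  | succ n ih =>
    have h1 := ih (f := fun j => f j.succ) (s := fun j => s j.succ) (fun j => h0 j.succ)
      fun j => hf j.succ
    have h2 := hasSum_mul_of_nonneg (hf 0) h1 (h0 0)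
      fun l => Finset.prod_nonneg fun j _ => h0 _ _
    have e : (fun l : Fin (n + 1) → ℕ => ∏ j, f j (l j)) ∘ (Fin.consEquiv fun _ => ℕ) =
        fun x : ℕ × (Fin n → ℕ) => f 0 x.1 * ∏ j : Fin n, f j.succ (x.2 j) := by
      funext x
      simp [Fin.prod_univ_succ, Fin.consEquiv]
    rw [Fin.prod_univ_succ, ← (Fin.consEquiv fun _ => ℕ).hasSum_iff, e]
    exact h2

theorem hasSum_succ_geometric {r : ℝ} (h0 : 0 ≤ r) (h1 : r < 1) :
    HasSum (fun l : ℕ => ((l : ℝ) + 1) * ((1 - r) * r ^ l)) (1 / (1 - r)) := by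
  have hn : ‖r‖ < 1 := by rwa [Real.norm_of_nonneg h0]
  have h := ((hasSum_coe_mul_geometric_of_norm_lt_one hn).add
    (hasSum_geometric_of_lt_one h0 h1)).mul_left (1 - r)
  have hne : 1 - r ≠ 0 := by linarith
  have e1 : (fun l : ℕ => ((l : ℝ) + 1) * ((1 - r) * r ^ l)) =
      fun l : ℕ => (1 - r) * ((l : ℝ) * r ^ l + r ^ l) := by
    funext l
    ring
  have e2 : 1 / (1 - r) = (1 - r) * (r / (1 - r) ^ 2 + (1 - r)⁻¹) := by
    field_simp
    ring
  rw [e1, e2]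
  exact h

namespace BTSNetwork

variable {n : ℕ} {S : BTSNetwork n}

theorem intraLaw_nonneg (hS : S.Stable) (j : Fin n) (A : Finset (Fin n)) (l : ℕ) :
    0 ≤ S.intraLaw j A l := by
  unfold intraLaw
  split_ifs with hj hl
  · exact le_rfl
  · have h := hS.arr_lt_rate hj
    have hpos := (S.arr_pos j).trans h
    have h1 : S.arr j / S.rate j A ≤ 1 := (div_le_one hpos).2 h.le
    exact mul_nonneg (by linarith) (pow_nonneg (div_pos (S.arr_pos j) hpos).le _)
  · exact zero_le_one
  · exact le_rfl

theorem hasSum_intraLaw (hS : S.Stable) (j : Fin n) (A : Finset (Fin n)) :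
    HasSum (S.intraLaw j A) 1 := by
  by_cases hj : j ∈ A
  · have h := hS.arr_lt_rate hj
    have hpos := (S.arr_pos j).trans h
    have h1 : S.arr j / S.rate j A < 1 := (div_lt_one hpos).2 h
    rw [← hasSum_nat_add_iff' 1]
    have h2 := (hasSum_geometric_of_lt_one (div_pos (S.arr_pos j) hpos).le h1).mul_left
      (1 - S.arr j / S.rate j A)
    rw [mul_inv_cancel₀ (by linarith)] at h2
    simpa [intraLaw, hj] using h2
  · convert hasSum_ite_eq 0 (1 : ℝ) using 2 with l
    simp [intraLaw, hj]

/-- Mean length of queue `j` given the set of active BTSs. -/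
theorem hasSum_mul_intraLaw (hS : S.Stable) (j : Fin n) (A : Finset (Fin n)) :
    HasSum (fun l : ℕ => (l : ℝ) * S.intraLaw j A l)
      (if j ∈ A then S.rate j A / (S.rate j A - S.arr j) else 0) := by
  by_cases hj : j ∈ A
  · have h := hS.arr_lt_rate hj
    have hpos := (S.arr_pos j).trans h
    have h1 : S.arr j / S.rate j A < 1 := (div_lt_one hpos).2 h
    rw [← hasSum_nat_add_iff' 1]
    have h2 := hasSum_succ_geometric (div_pos (S.arr_pos j) hpos).le h1
    have e : 1 / (1 - S.arr j / S.rate j A) = S.rate j A / (S.rate j A - S.arr j) := by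
      have := sub_pos.2 h
      rw [one_sub_div hpos.ne', one_div_div]
    rw [e] at h2
    simpa [intraLaw, hj] using h2
  · convert hasSum_zero using 1
    · funext l
      by_cases hl : l = 0 <;> simp [intraLaw, hj, hl]
    · simp [hj]

theorem prod_intraLaw_eq_zero (S : BTSNetwork n) {A : Finset (Fin n)} {l : Fin n → ℕ}
    (h : activeSet l ≠ A) : ∏ j, S.intraLaw j A (l j) = 0 := by
  by_contra hne
  refine h ?_
  ext j
  have hj := Finset.prod_ne_zero_iff.1 hne j (Finset.mem_univ j)
  by_cases hA : j ∈ A <;> by_cases hl : l j = 0 <;>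
    simp_all [intraLaw, activeSet, Nat.pos_iff_ne_zero]

/-- The intra-group laws charge only queue vectors whose active set is `A`, so the joint law is a
mixture of product laws. -/
theorem jointLaw_eq_sum (S : BTSNetwork n) (p : Finset (Fin n) → ℝ) (l : Fin n → ℕ) :
    S.jointLaw p l = ∑ A, p A * ∏ j, S.intraLaw j A (l j) := by
  rw [Finset.sum_eq_single (activeSet l)]
  · rfl
  · intro A _ hA
    rw [S.prod_intraLaw_eq_zero hA.symm, mul_zero]
  · exact fun h => absurd (Finset.mem_univ _) h

/-- Little's law for the modified queueing system. -/
theorem hasSum_queueLength (hS : S.Stable) (p : Finset (Fin n) → ℝ) (i : Fin n) :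
    HasSum (fun l : Fin n → ℕ => (l i : ℝ) * S.jointLaw p l)
      (S.arr i * S.refinedSojourn p i) := by
  have hA : ∀ A, HasSum (fun l : Fin n → ℕ => (l i : ℝ) * ∏ j, S.intraLaw j A (l j))
      (if i ∈ A then S.rate i A / (S.rate i A - S.arr i) else 0) := fun A => by
    -- The weight `l i` is put into factor `i` alone; the other factors sum to one.
    have h := hasSum_fin_prod
      (f := fun j l => (if j = i then (l : ℝ) else 1) * S.intraLaw j A l)
      (s := fun j => if j = i then
        (if i ∈ A then S.rate i A / (S.rate i A - S.arr i) else 0) else 1)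
      (fun j l => mul_nonneg (by split_ifs <;> simp) (intraLaw_nonneg hS j A l))
      (fun j => by
        by_cases hj : j = i
        · subst hj
          simpa only [if_true] using hasSum_mul_intraLaw hS j A
        · simpa only [hj, if_false, one_mul] using hasSum_intraLaw hS j A)
    simp only [Finset.prod_mul_distrib, Finset.prod_ite_eq', Finset.mem_univ, if_true] at h
    exact h
  have h := hasSum_sum (s := Finset.univ) fun A _ => (hA A).mul_left (p A)
  have e1 : (fun l : Fin n → ℕ => (l i : ℝ) * S.jointLaw p l) =
      fun l => ∑ A, p A * ((l i : ℝ) * ∏ j, S.intraLaw j A (l j)) := by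
    funext l
    rw [jointLaw_eq_sum, Finset.mul_sum]
    exact Finset.sum_congr rfl fun A _ => by ring
  have e2 : S.arr i * S.refinedSojourn p i =
      ∑ A, p A * if i ∈ A then S.rate i A / (S.rate i A - S.arr i) else 0 := by
    unfold refinedSojourn
    rw [Finset.mul_sum, Finset.sum_filter]
    refine Finset.sum_congr rfl fun A _ => ?_
    split_ifs with hi
    · have h1 := (S.arr_pos i).ne'
      have h2 := (sub_pos.2 (hS.arr_lt_rate hi)).ne'
      field_simp
    · simp
  rw [e1, e2]
  exact h

end BTSNetwork

/-! ### The two couplings with product chains -/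

namespace BTSNetwork

open DrivenDynamics

variable {n : ℕ} {S : BTSNetwork n}

/-- The dynamics `M` are a version of the lumped chain in which BTS `i` is not driven. -/
structure IsDrivenBy (S : BTSNetwork n) (M : DrivenDynamics (Fin n)) (i : Fin n) : Prop where
  R_self : M.R i = 0
  R_pos : ∀ j, j ≠ i → 0 < M.R j
  up : ∀ j, M.R j * M.a j + M.u j = S.arr j
  down : ∀ j A, j ∈ A → M.R j * (1 - M.a j) * M.c j A + M.d j A = S.rate j A - S.arr j

/-- The lumped chain driven by a product chain dominating the active sets of the other BTSs. -/
noncomputable def upperDynamics (hS : S.Stable) (i : Fin n) : DrivenDynamics (Fin n) where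
  R j := if j = i then 0 else S.rate j Finset.univ
  a := S.worstActivity
  u j := if j = i then S.arr i else 0
  D j := S.rate j {j}
  c _ _ := 1
  d j A := if j ∈ A then (if j = i then S.rate i A - S.arr i else S.rate j A - S.rate j Finset.univ)
    else 0
  rel y A := A ⊆ insert i y
  R_nonneg j := by
    split_ifs
    · exact le_rfl
    · exact ((S.arr_pos j).trans (hS j)).le
  a_pos j := div_pos (S.arr_pos j) ((S.arr_pos j).trans (hS j))
  a_lt_one j := (div_lt_one ((S.arr_pos j).trans (hS j))).2 (hS j)
  u_nonneg j := by
    split_ifs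
    · exact (S.arr_pos i).le
    · exact le_rfl
  c_nonneg _ _ := zero_le_one
  c_le_one _ _ := le_rfl
  c_antitone _ _ _ _ _ := le_rfl
  d_nonneg j A := by
    split_ifs with hA hj
    · subst hj
      exact (sub_pos.2 (hS.arr_lt_rate hA)).le
    · exact sub_nonneg.2 (S.rate_antitone hA (Finset.subset_univ A))
    · exact le_rfl
  d_le j A := by
    have hu := (S.arr_pos j).trans (hS j)
    have hs := hS.arr_lt_rate (Finset.mem_singleton_self j)
    split_ifs with hA hj
    · subst hj
      linarith [S.rate_antitone (Finset.mem_singleton_self j) (Finset.singleton_subset_iff.2 hA),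
        S.arr_pos j]
    · linarith [S.rate_antitone (Finset.mem_singleton_self j) (Finset.singleton_subset_iff.2 hA)]
    · linarith [S.arr_pos j]
  d_antitone j A B hA hAB := by
    simp only [hA, hAB hA, if_true]
    split_ifs with hj
    · subst hj
      linarith [S.rate_antitone hA hAB]
    · linarith [S.rate_antitone hA hAB]
  rel_self A := Finset.subset_insert i A
  rel_join j y A _ hj h := by grind
  rel_stay _ _ _ _ _ _ := Or.inl rfl
  rel_leave j y A _ hj h := by grind
  rel_add j y A hu h := by grind
  rel_drop j y A h := Or.inr ((Finset.erase_subset j A).trans h)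

theorem isDrivenBy_upperDynamics (hS : S.Stable) (i : Fin n) :
    S.IsDrivenBy (upperDynamics hS i) i where
  R_self := if_pos rfl
  R_pos j hj := by
    simp only [upperDynamics, if_neg hj]
    exact (S.arr_pos j).trans (hS j)
  up j := by
    have hu := ((S.arr_pos j).trans (hS j)).ne'
    by_cases hj : j = i
    · subst hj
      simp [upperDynamics]
    · simp only [upperDynamics, if_neg hj, worstActivity]
      field_simp
      ring
  down j A hA := by
    have hu := ((S.arr_pos j).trans (hS j)).ne'
    by_cases hj : j = i
    · subst hj
      simp [upperDynamics, hA]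
    · simp only [upperDynamics, if_neg hj, worstActivity, if_pos hA]
      field_simp
      ring

/-- The lumped chain driven by a product chain dominated by the active sets of the other BTSs. -/
noncomputable def lowerDynamics (hS : S.Stable) (i : Fin n) : DrivenDynamics (Fin n) where
  R j := if j = i then 0 else S.rate j {j}
  a := S.bestActivity
  u j := if j = i then S.arr i else 0
  D j := S.rate j {j}
  c j A := if j ∈ A then (S.rate j A - S.arr j) / (S.rate j {j} - S.arr j) else 0
  d j A := if j ∈ A ∧ j = i then S.rate i A - S.arr i else 0
  rel y A := y ⊆ insert i A
  R_nonneg j := by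
    split_ifs
    · exact le_rfl
    · exact ((S.arr_pos j).trans (hS.arr_lt_rate (Finset.mem_singleton_self j))).le
  a_pos j := div_pos (S.arr_pos j)
    ((S.arr_pos j).trans (hS.arr_lt_rate (Finset.mem_singleton_self j)))
  a_lt_one j := (div_lt_one
    ((S.arr_pos j).trans (hS.arr_lt_rate (Finset.mem_singleton_self j)))).2
      (hS.arr_lt_rate (Finset.mem_singleton_self j))
  u_nonneg j := by
    split_ifs
    · exact (S.arr_pos i).le
    · exact le_rfl
  c_nonneg j A := by
    split_ifs with hA
    · exact (div_pos (sub_pos.2 (hS.arr_lt_rate hA))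
        (sub_pos.2 (hS.arr_lt_rate (Finset.mem_singleton_self j)))).le
    · exact le_rfl
  c_le_one j A := by
    split_ifs with hA
    · rw [div_le_one (sub_pos.2 (hS.arr_lt_rate (Finset.mem_singleton_self j)))]
      linarith [S.rate_antitone (Finset.mem_singleton_self j) (Finset.singleton_subset_iff.2 hA)]
    · exact zero_le_one
  c_antitone j A B hA hAB := by
    simp only [hA, hAB hA, if_true]
    exact div_le_div_of_nonneg_right (by linarith [S.rate_antitone hA hAB])
      (sub_pos.2 (hS.arr_lt_rate (Finset.mem_singleton_self j))).le
  d_nonneg j A := by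
    split_ifs with h
    · obtain ⟨hA, rfl⟩ := h
      exact (sub_pos.2 (hS.arr_lt_rate hA)).le
    · exact le_rfl
  d_le j A := by
    have hs := hS.arr_lt_rate (Finset.mem_singleton_self j)
    split_ifs with h
    · obtain ⟨hA, rfl⟩ := h
      linarith [S.rate_antitone (Finset.mem_singleton_self j) (Finset.singleton_subset_iff.2 hA),
        S.arr_pos j]
    · linarith [S.arr_pos j]
  d_antitone j A B hA hAB := by
    simp only [hA, hAB hA, true_and]
    split_ifs with hj
    · subst hj
      linarith [S.rate_antitone hA hAB]
    · exact le_rfl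
  rel_self A := Finset.subset_insert i A
  rel_join j y A _ hj h := by
    intro x hx
    rcases h with h | h <;> have := @h x <;> grind
  rel_stay j y A _ hj h := by grind
  rel_leave j y A _ hj h := by
    intro x hx
    rcases h with h | h <;> have := @h x <;> grind
  rel_add j y A hu h := by grind
  rel_drop j y A h := by grind

theorem isDrivenBy_lowerDynamics (hS : S.Stable) (i : Fin n) :
    S.IsDrivenBy (lowerDynamics hS i) i where
  R_self := if_pos rfl
  R_pos j hj := by
    simp only [lowerDynamics, if_neg hj]
    exact (S.arr_pos j).trans (hS.arr_lt_rate (Finset.mem_singleton_self j))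
  up j := by
    have hu := ((S.arr_pos j).trans (hS.arr_lt_rate (Finset.mem_singleton_self j))).ne'
    by_cases hj : j = i
    · subst hj
      simp [lowerDynamics]
    · simp only [lowerDynamics, if_neg hj, bestActivity]
      field_simp
      ring
  down j A hA := by
    have hu := ((S.arr_pos j).trans (hS.arr_lt_rate (Finset.mem_singleton_self j))).ne'
    have hd := (sub_pos.2 (hS.arr_lt_rate (Finset.mem_singleton_self j))).ne'
    by_cases hj : j = i
    · subst hj
      simp [lowerDynamics, hA]
    · simp only [lowerDynamics, if_neg hj, bestActivity, if_pos hA,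
        if_neg fun h : j ∈ A ∧ j = i => hj h.2]
      field_simp
      ring

variable {M : DrivenDynamics (Fin n)} {i : Fin n}

theorem sum_marginal_mul {F : Finset (Fin n) → (Finset (Fin n) → ℝ) → ℝ} (hF : M.IsKernel F)
    (φ : Finset (Fin n) → ℝ) :
    ∑ A, bernoulliMean M.a (fun y => F y (Pi.single A 1)) * φ A =
      bernoulliMean M.a fun y => F y φ := by
  have h : ∀ y, F y φ = ∑ A, φ A * F y (Pi.single A 1) := fun y => by
    have e : φ = ∑ A, φ A • (Pi.single A (1 : ℝ) : Finset (Fin n) → ℝ) := by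
      funext B
      simp [Finset.sum_apply, Pi.single_apply]
    have h2 := congrArg (hF.toLinearMap y) e
    rw [map_sum] at h2
    simp only [map_smul, smul_eq_mul] at h2
    exact h2
  simp only [h]
  rw [bernoulliMean_sum]
  exact Finset.sum_congr rfl fun A _ => by rw [bernoulliMean_const_mul, mul_comm]

/-- The combined join and leave rates of the driven chain are those of the lumped chain. This yields
existence of a stationary law and, by uniqueness, identifies `p` as the marginal. -/
theorem isStationary_marginal (hM : S.IsDrivenBy M i)
    {F : Finset (Fin n) → (Finset (Fin n) → ℝ) → ℝ} (hF : M.IsKernel F) (h1 : ∀ y, F y 1 = 1)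
    (hst : ∀ y φ, ∑ j, M.move j F y φ = (∑ j, (M.R j + M.u j + M.D j)) * F y φ) :
    S.IsStationary fun A => bernoulliMean M.a (fun y => F y (Pi.single A 1)) := by
  refine ⟨fun A => ?_, ?_, ?_⟩
  · rw [← bernoulliMean_const M.a 0]
    refine bernoulliMean_mono (fun j => (M.a_pos j).le) (fun j => (M.a_lt_one j).le) fun y => ?_
    refine hF.nonneg _ _ fun B _ => ?_
    by_cases hB : B = A <;> simp [hB]
  · have h := sum_marginal_mul hF 1
    simp only [h1, bernoulliMean_const, Pi.one_apply, mul_one] at h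
    exact h
  · rw [vecMul_lumpedGenerator_eq_zero_iff]
    intro φ
    rw [sum_marginal_mul hF (fun A => ∑ i, (S.arr i * (φ (insert i A) - φ A) +
        S.downRate i A * (φ (A.erase i) - φ A)))]
    rw [← bernoulliMean_stationary hF hst φ]
    congr 1
    funext y
    congr 1
    funext A
    refine Finset.sum_congr rfl fun j _ => ?_
    rw [hM.up j]
    by_cases hj : j ∈ A
    · rw [hM.down j A hj, downRate, if_pos hj]
    · rw [Finset.erase_eq_of_notMem hj, sub_self, mul_zero, mul_zero]

/-- The lumped chain has exactly one stationary distribution. -/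
theorem existsUnique_isStationary (hS : S.Stable) :
    ∃! p : Finset (Fin n) → ℝ, S.IsStationary p := by
  have hex : ∃ p : Finset (Fin n) → ℝ, S.IsStationary p := by
    rcases isEmpty_or_nonempty (Fin n) with hn | ⟨⟨i⟩⟩
    · refine ⟨fun _ => 1, fun _ => zero_le_one, by simp, ?_⟩
      rw [vecMul_lumpedGenerator_eq_zero_iff]
      simp
    · obtain ⟨F, hF, h1, hst⟩ := (upperDynamics hS i).exists_stationary_kernel
      exact ⟨_, isStationary_marginal (isDrivenBy_upperDynamics hS i) hF h1 hst⟩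
  obtain ⟨p, hp⟩ := hex
  exact ⟨p, hp, fun q hq => hq.eq hS hp⟩

/-- The stationary distribution of the lumped chain disintegrates along the driving product
chain. -/
theorem IsStationary.exists_kernel (hS : S.Stable) {p : Finset (Fin n) → ℝ}
    (hp : S.IsStationary p) (hM : S.IsDrivenBy M i) :
    ∃ F, M.IsKernel F ∧
      (∀ y, ∑ j, M.R j * (resample M.a j (fun z => F z (occupied i)) y - F y (occupied i)) +
        S.arr i = F y (fun A => S.rate i A * occupied i A)) ∧
      ∀ φ, ∑ A, p A * φ A = bernoulliMean M.a fun y => F y φ := by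
  obtain ⟨F, hF, h1, hst⟩ := M.exists_stationary_kernel
  refine ⟨F, hF, fun y => ?_, fun φ => ?_⟩
  · have h := occupation_equation hF h1 hst hM.R_self y
    have hu : M.u i = S.arr i := by
      rw [← hM.up i, hM.R_self, zero_mul, zero_add]
    have e : (fun A => M.d i A * occupied i A) =
        (fun A => S.rate i A * occupied i A) + (-S.arr i) • occupied i := by
      funext A
      simp only [occupied, Pi.add_apply, Pi.smul_apply, smul_eq_mul]
      split_ifs with hA
      · have h2 := hM.down i A hA
        rw [hM.R_self] at h2
        linarith
      · simp
    rw [e, hF.map_add, hF.map_smul, hu] at h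
    linarith
  · rw [hp.eq hS (isStationary_marginal hM hF h1 hst)]
    exact sum_marginal_mul hF φ

/-! ### The sojourn time bounds -/

theorem arr_mul_refinedSojourn (hS : S.Stable) (p : Finset (Fin n) → ℝ) (i : Fin n) :
    S.arr i * S.refinedSojourn p i =
      ∑ A, p A * ((1 + S.arr i * (1 / (S.rate i A - S.arr i))) * occupied i A) := by
  unfold refinedSojourn
  rw [Finset.mul_sum, Finset.sum_filter]
  refine Finset.sum_congr rfl fun A _ => ?_
  unfold occupied
  split_ifs with hi
  · have h1 := (S.arr_pos i).ne'
    have h2 := (sub_pos.2 (hS.arr_lt_rate hi)).ne'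
    field_simp
    ring
  · simp

theorem upperSojourn_eq (S : BTSNetwork n) (i : Fin n) : S.upperSojourn i =
    bernoulliMean S.worstActivity fun y => 1 / (S.rate i (insert i y) - S.arr i) :=
  (bernoulliMean_of_insensitive _ i fun B => 1 / (S.rate i B - S.arr i)).symm

theorem lowerSojourn_eq (S : BTSNetwork n) (i : Fin n) : S.lowerSojourn i =
    1 / (bernoulliMean S.bestActivity (fun y => S.rate i (insert i y)) - S.arr i) := by
  rw [bernoulliMean_of_insensitive _ i (S.rate i)]
  rfl

theorem rate_insert_antitone (S : BTSNetwork n) (i : Fin n) :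
    Antitone fun y => S.rate i (insert i y) := fun y _ h =>
  S.rate_antitone (Finset.mem_insert_self i y) (Finset.insert_subset_insert i h)

/-- The activity of BTS `i` cannot be locally unaffected by everything its service rate is
affected by. -/
theorem false_of_interference
    (hlt : S.rate i Finset.univ < S.rate i {i}) {h : Finset (Fin n) → ℝ} (hh : Monotone h)
    (hh0 : ∀ y, 0 ≤ h y)
    (he : ∀ y, ∑ j, M.R j * (resample M.a j h y - h y) + S.arr i = S.rate i (insert i y) * h y)
    (hedge : ∀ k, k ≠ i → ∀ y, k ∉ y →
      S.rate i (insert i (insert k y)) < S.rate i (insert i y) → h (insert k y) = h y) :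
    False := by
  have hconst : ∀ y, i ∉ y → S.rate i (insert i y) = S.rate i {i} := by
    intro y
    induction y using Finset.induction_on with
    | empty => simp
    | insert k y hk ih =>
      intro hi
      -- BTSs are added one at a time; a drop of the rate at any addition would contradict the
      -- resolvent equation.
      rw [Finset.mem_insert, not_or] at hi
      rw [← ih hi.2]
      refine (S.rate_insert_antitone i (Finset.subset_insert k y)).antisymm ?_
      by_contra hlt'
      have hlt' := not_le.1 hlt'
      exact not_monotone_of_resolvent (fun j => (M.a_pos j).le) (fun j => (M.a_lt_one j).le)
        M.R_nonneg (S.arr_pos i) hh hh0 (g := fun y => S.rate i (insert i y)) he hlt'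
        (hedge k (Ne.symm hi.1) y hk hlt')
  have h2 := hconst (Finset.univ.erase i) (Finset.notMem_erase i _)
  rw [Finset.insert_erase (Finset.mem_univ i)] at h2
  linarith

theorem occupied_nonneg (i : Fin n) (A : Finset (Fin n)) : 0 ≤ occupied i A := by
  unfold occupied
  split_ifs
  · exact zero_le_one
  · exact le_rfl

/-- Throughput equals arrival rate: resampling preserves means, so the generator term averages to
zero. -/
theorem mean_rate_occupied {F : Finset (Fin n) → (Finset (Fin n) → ℝ) → ℝ}
    (he : ∀ y, ∑ j, M.R j * (resample M.a j (fun z => F z (occupied i)) y - F y (occupied i)) +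
        S.arr i = F y (fun A => S.rate i A * occupied i A)) :
    bernoulliMean M.a (fun y => F y (fun A => S.rate i A * occupied i A)) = S.arr i := by
  simp only [← he]
  rw [bernoulliMean_add, bernoulliMean_const, bernoulliMean_sum]
  simp only [bernoulliMean_const_mul, bernoulliMean_sub]
  rw [Finset.sum_eq_zero, zero_add]
  intro j _
  change _ * (bernoulliMean M.a (resample M.a j _) - _) = 0
  rw [bernoulliMean_resample, sub_self, mul_zero]

theorem refinedSojourn_upper (hS : S.Stable) {p : Finset (Fin n) → ℝ} (hp : S.IsStationary p)
    (i : Fin n) : S.refinedSojourn p i ≤ S.upperSojourn i ∧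
      (S.rate i Finset.univ < S.rate i {i} → S.refinedSojourn p i < S.upperSojourn i) := by
  have hM := isDrivenBy_upperDynamics hS i
  obtain ⟨F, hF, he, hsum⟩ := hp.exists_kernel hS hM
  have hrel : ∀ y A, (upperDynamics hS i).rel y A ↔ A ⊆ insert i y := fun _ _ => Iff.rfl
  have ha : (upperDynamics hS i).a = S.worstActivity := rfl
  generalize upperDynamics hS i = M at *
  have a0 := fun j => (M.a_pos j).le
  have a1 := fun j => (M.a_lt_one j).le
  have hl := S.arr_pos i
  let h : Finset (Fin n) → ℝ := fun y => F y (occupied i)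
  let g : Finset (Fin n) → ℝ := fun y => S.rate i (insert i y)
  let f : Finset (Fin n) → ℝ := fun y => 1 / (g y - S.arr i)
  let q : Finset (Fin n) → ℝ := fun y => F y (fun A => S.rate i A * occupied i A)
  have hh : Monotone h := hF.mono _ (occupied_mono i)
  have hh0 : ∀ y, 0 ≤ h y := fun y => hF.nonneg _ _ fun A _ => occupied_nonneg i A
  have hg : ∀ y, 0 < g y - S.arr i := fun y =>
    sub_pos.2 (hS.arr_lt_rate (Finset.mem_insert_self i y))
  have hf0 : ∀ y, 0 < f y := fun y => one_div_pos.2 (hg y)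
  have hf : Monotone f := fun y z hyz =>
    one_div_le_one_div_of_le (hg z) (sub_le_sub_right (S.rate_insert_antitone i hyz) _)
  have hgf : ∀ y, f y * g y = 1 + S.arr i * f y := fun y => by
    have := (hg y).ne'
    simp only [f]
    field_simp
    ring
  have hq : ∀ y, g y * h y ≤ q y := fun y => by
    rw [← hF.map_const_mul]
    refine hF.le fun A hA => ?_
    unfold occupied
    split_ifs with hi
    · linarith [S.rate_antitone hi ((hrel y A).1 hA)]
    · simp
  -- $1+\lambda_i/(r_{i,A}-\lambda_i)$ increases with $A\ni i$, and $A\subseteq y\cup\{i\}$ bounds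
  -- it by $1+\lambda_i f(y)=f(y)g(y)$.
  have ht : S.arr i * S.refinedSojourn p i ≤ bernoulliMean M.a fun y => f y * (g y * h y) := by
    rw [arr_mul_refinedSojourn hS, hsum]
    refine bernoulliMean_mono a0 a1 fun y => ?_
    rw [← mul_assoc, hgf, ← hF.map_const_mul]
    refine hF.le fun A hA => ?_
    unfold occupied
    split_ifs with hi
    · have h2 : 1 / (S.rate i A - S.arr i) ≤ f y :=
        one_div_le_one_div_of_le (hg y) (sub_le_sub_right (S.rate_antitone hi ((hrel y A).1 hA)) _)
      nlinarith
    · simp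
  have hle : ∀ y, f y * (g y * h y) ≤ f y * q y := fun y =>
    mul_le_mul_of_nonneg_left (hq y) (hf0 y).le
  -- The occupation equation is multiplied by $f$ and averaged; the subtracted sum is a Dirichlet
  -- form of two increasing functions.
  have hfq : bernoulliMean M.a (fun y => f y * q y) = S.arr i * bernoulliMean M.a f -
      ∑ j, M.R j * bernoulliMean M.a (fun y => f y * (h y - resample M.a j h y)) := by
    have e : ∀ y, f y * q y =
        S.arr i * f y - ∑ j, M.R j * (f y * (h y - resample M.a j h y)) := fun y => by
      have h2 : ∑ j, M.R j * (f y * (h y - resample M.a j h y)) =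
          -(f y * ∑ j, M.R j * (resample M.a j h y - h y)) := by
        rw [Finset.mul_sum, ← Finset.sum_neg_distrib]
        exact Finset.sum_congr rfl fun j _ => by ring
      rw [h2]
      simp only [q]
      rw [← he y]
      ring
    simp only [e]
    rw [bernoulliMean_sub, bernoulliMean_const_mul, bernoulliMean_sum]
    simp only [bernoulliMean_const_mul]
  have hdir : ∀ j, 0 ≤ M.R j * bernoulliMean M.a (fun y => f y * (h y - resample M.a j h y)) :=
    fun j => mul_nonneg (M.R_nonneg j) (bernoulliMean_mul_sub_resample_nonneg a0 a1 hf hh j)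
  have hdirsum := Finset.sum_nonneg fun j (_ : j ∈ Finset.univ) => hdir j
  have hmle := bernoulliMean_mono a0 a1 hle
  have hup : S.upperSojourn i = bernoulliMean M.a f := by rw [upperSojourn_eq, ha]
  rw [hup]
  refine ⟨le_of_mul_le_mul_left (by linarith) hl, fun hlt => ?_⟩
  by_contra hcon
  have hcon' := mul_le_mul_of_nonneg_left (not_lt.1 hcon) hl.le
  have heq : ∀ y, g y * h y = q y := fun y => mul_left_cancel₀ (hf0 y).ne'
    (eq_of_bernoulliMean_eq M.a_pos M.a_lt_one hle (le_antisymm hmle (by linarith)) y)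
  have hz := (Finset.sum_eq_zero_iff_of_nonneg fun j _ => hdir j).1
    (le_antisymm (by linarith) hdirsum)
  refine false_of_interference hlt hh hh0 (fun y => (he y).trans (heq y).symm)
    fun k hk y hky hgk => ?_
  have h2 := (mul_eq_zero.1 (hz k (Finset.mem_univ k))).resolve_left (hM.R_pos k hk).ne'
  have h3 := mul_sub_eq_zero_of_bernoulliMean_nonpos M.a_pos M.a_lt_one hf hh h2.le y
  rw [Finset.erase_eq_of_notMem hky] at h3
  have h4 : f y < f (insert k y) := one_div_lt_one_div_of_lt (hg _) (sub_lt_sub_right hgk _)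
  exact sub_eq_zero.1 ((mul_eq_zero.1 h3).resolve_left (sub_pos.2 h4).ne')

/-- Jensen bound: the sojourn time is at least that of a queue served at the mean rate seen while
it is active. -/
theorem le_refinedSojourn (hS : S.Stable) {p : Finset (Fin n) → ℝ} (hp : S.IsStationary p)
    {i : Fin n} (hbal : ∑ A, p A * (S.rate i A * occupied i A) = S.arr i) :
    let P := ∑ A, p A * occupied i A
    0 < P ∧ 0 < S.arr i / P - S.arr i ∧ 1 / (S.arr i / P - S.arr i) ≤ S.refinedSojourn p i := by
  intro P
  have hl := S.arr_pos i
  have hP : 0 < P := Finset.sum_pos' (fun A _ => mul_nonneg (hp.1 A) (occupied_nonneg i A))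
    ⟨{i}, Finset.mem_univ _, mul_pos (hp.pos hS _) (by simp [occupied])⟩
  have hcomb : ∀ α β : ℝ, ∑ A, p A * ((α + β * S.rate i A) * occupied i A) =
      α * P + β * S.arr i := fun α β => by
    rw [← hbal, Finset.mul_sum, Finset.mul_sum, ← Finset.sum_add_distrib]
    exact Finset.sum_congr rfl fun A _ => by ring
  have hP1 : 0 < S.arr i - S.arr i * P := by
    have e : S.arr i - S.arr i * P = ∑ A, p A * ((S.rate i A - S.arr i) * occupied i A) := by
      have h := hcomb (-S.arr i) 1
      rw [show S.arr i - S.arr i * P = -S.arr i * P + 1 * S.arr i by ring, ← h]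
      exact Finset.sum_congr rfl fun A _ => by ring
    rw [e]
    refine Finset.sum_pos' (fun A _ => mul_nonneg (hp.1 A) ?_)
      ⟨{i}, Finset.mem_univ _, mul_pos (hp.pos hS _) ?_⟩
    · unfold occupied
      split_ifs with hi
      · linarith [hS.arr_lt_rate hi]
      · simp
    · have := hS.arr_lt_rate (Finset.mem_singleton_self i)
      simp only [occupied, Finset.mem_singleton_self, if_true]
      linarith
  have hm : 0 < S.arr i / P - S.arr i := by
    rw [sub_pos, lt_div_iff₀ hP]
    linarith
  refine ⟨hP, hm, le_of_mul_le_mul_left ?_ hl⟩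
  -- By the balance `hbal`, this is the mean of $r_{i,A}-\lambda_i$ given that $i$ is active.
  -- Jensen's inequality is obtained from the tangent to $1/x$ at `m`.
  set m := S.arr i / P - S.arr i with hmdef
  have hPm : P * (m + S.arr i) = S.arr i := by
    rw [hmdef]
    field_simp
    ring
  have htan : ∀ x : ℝ, 0 < x → 2 / m - x / m ^ 2 ≤ 1 / x := fun x hx => by
    have e : 1 / x - (2 / m - x / m ^ 2) = (x - m) ^ 2 / (x * m ^ 2) := by
      field_simp
      ring
    have h2 : 0 ≤ (x - m) ^ 2 / (x * m ^ 2) := by positivity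
    linarith
  have hlow : ∑ A, p A * ((1 + S.arr i * (2 / m - (S.rate i A - S.arr i) / m ^ 2)) * occupied i A)
      ≤ S.arr i * S.refinedSojourn p i := by
    rw [arr_mul_refinedSojourn hS]
    refine Finset.sum_le_sum fun A _ => mul_le_mul_of_nonneg_left ?_ (hp.1 A)
    unfold occupied
    split_ifs with hi
    · have h2 := mul_le_mul_of_nonneg_left (htan _ (sub_pos.2 (hS.arr_lt_rate hi))) hl.le
      linarith
    · simp
  have hev : ∑ A, p A * ((1 + S.arr i * (2 / m - (S.rate i A - S.arr i) / m ^ 2)) * occupied i A)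
      = (1 + S.arr i * (2 / m + S.arr i / m ^ 2)) * P - S.arr i / m ^ 2 * S.arr i := by
    have h := hcomb (1 + S.arr i * (2 / m + S.arr i / m ^ 2)) (-(S.arr i / m ^ 2))
    rw [sub_eq_add_neg, ← neg_mul, ← h]
    exact Finset.sum_congr rfl fun A _ => by ring
  rw [hev] at hlow
  refine le_trans (le_of_eq ?_) hlow
  have hP' : P = S.arr i / (m + S.arr i) := by
    rw [eq_div_iff (by positivity)]
    exact hPm
  rw [hP']
  have := (add_pos hm hl).ne'
  field_simp
  ring

theorem refinedSojourn_lower (hS : S.Stable) {p : Finset (Fin n) → ℝ} (hp : S.IsStationary p)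
    (i : Fin n) : S.lowerSojourn i ≤ S.refinedSojourn p i ∧
      (S.rate i Finset.univ < S.rate i {i} → S.lowerSojourn i < S.refinedSojourn p i) := by
  have hM := isDrivenBy_lowerDynamics hS i
  obtain ⟨F, hF, he, hsum⟩ := hp.exists_kernel hS hM
  have hrel : ∀ y A, (lowerDynamics hS i).rel y A ↔ y ⊆ insert i A := fun _ _ => Iff.rfl
  have ha : (lowerDynamics hS i).a = S.bestActivity := rfl
  generalize lowerDynamics hS i = M at *
  have a0 := fun j => (M.a_pos j).le
  have a1 := fun j => (M.a_lt_one j).le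
  have hmean := mean_rate_occupied he
  obtain ⟨hP, hm, hjen⟩ := le_refinedSojourn hS hp ((hsum _).trans hmean)
  rw [hsum] at hP hm hjen
  let h : Finset (Fin n) → ℝ := fun y => F y (occupied i)
  let g : Finset (Fin n) → ℝ := fun y => S.rate i (insert i y)
  let q : Finset (Fin n) → ℝ := fun y => F y (fun A => S.rate i A * occupied i A)
  have hh : Monotone h := hF.mono _ (occupied_mono i)
  have hh0 : ∀ y, 0 ≤ h y := fun y => hF.nonneg _ _ fun A _ => occupied_nonneg i A
  have hq : ∀ y, q y ≤ g y * h y := fun y => by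
    rw [← hF.map_const_mul]
    refine hF.le fun A hA => ?_
    unfold occupied
    split_ifs with hi
    · have hsub : insert i y ⊆ A := Finset.insert_subset hi
        (((hrel y A).1 hA).trans (Finset.insert_subset hi subset_rfl))
      linarith [S.rate_antitone (Finset.mem_insert_self i y) hsub]
    · simp
  have hf : Monotone fun y => -g y := (S.rate_insert_antitone i).neg
  have hmle := bernoulliMean_mono a0 a1 hq
  have hneg : bernoulliMean M.a (fun y => -g y) = -bernoulliMean M.a g := by
    have := bernoulliMean_const_mul M.a (-1) g
    simpa using this
  have hneg2 : bernoulliMean M.a (fun y => -g y * h y) = -bernoulliMean M.a fun y => g y * h y := by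
    have := bernoulliMean_const_mul M.a (-1) fun y => g y * h y
    simpa using this
  have hcov := bernoulliMean_mul_le a0 a1 hf hh
  rw [hneg, hneg2] at hcov
  have hGP : S.arr i ≤ bernoulliMean M.a g * bernoulliMean M.a h := by
    have h2 : bernoulliMean M.a q = S.arr i := hmean
    linarith
  have hlow : S.lowerSojourn i = 1 / (bernoulliMean M.a g - S.arr i) := by
    rw [lowerSojourn_eq, ha]
  rw [hlow]
  have hmG : S.arr i / bernoulliMean M.a h - S.arr i ≤ bernoulliMean M.a g - S.arr i :=
    sub_le_sub_right ((div_le_iff₀ hP).2 hGP) _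
  refine ⟨(one_div_le_one_div_of_le hm hmG).trans hjen, fun hlt => ?_⟩
  by_contra hcon
  -- Failure of strictness collapses $\lambda_i=Eq\le E[gh]\le Eg\,Eh$ to equalities: the first
  -- gives $q=gh$ pointwise, the second a vanishing covariance.
  have hge : bernoulliMean M.a g * bernoulliMean M.a h ≤ S.arr i := by
    by_contra hlt'
    have h3 : S.arr i / bernoulliMean M.a h - S.arr i < bernoulliMean M.a g - S.arr i :=
      sub_lt_sub_right ((div_lt_iff₀ hP).2 (not_le.1 hlt')) _
    exact hcon ((one_div_lt_one_div_of_lt hm h3).trans_le hjen)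
  have hmean' : bernoulliMean M.a q = S.arr i := hmean
  have heq : ∀ y, q y = g y * h y := eq_of_bernoulliMean_eq M.a_pos M.a_lt_one hq
    (le_antisymm hmle (by linarith))
  refine false_of_interference hlt hh hh0 (fun y => (he y).trans (heq y))
    fun k hk y hky hgk => ?_
  have h2 := bernoulliMean_mul_sub_resample_le a0 a1 hf hh k
  rw [hneg, hneg2] at h2
  have h3 := mul_sub_eq_zero_of_bernoulliMean_nonpos M.a_pos M.a_lt_one hf hh
    (h2.trans (by linarith)) y
  rw [Finset.erase_eq_of_notMem hky] at h3
  have h4 : g (insert k y) < g y := hgk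
  exact sub_eq_zero.1 ((mul_eq_zero.1 h3).resolve_left (by linarith [h4]))

end BTSNetwork

/-- In a stable network the lumped chain has exactly one stationary distribution `p`, `arr i * t i`
is the mean length of queue `i` in the modified system, and the refined approximate mean sojourn
time `t i` lies between the second-degree bounds, strictly as soon as BTS `i` is subject to
interference at all. -/
theorem theorem2 {n : ℕ} (S : BTSNetwork n) (hS : S.Stable) :
    (∃! p : Finset (Fin n) → ℝ, S.IsStationary p) ∧
    ∀ p : Finset (Fin n) → ℝ, S.IsStationary p → ∀ i : Fin n,
      HasSum (fun l : Fin n → ℕ => (l i : ℝ) * S.jointLaw p l) (S.arr i * S.refinedSojourn p i) ∧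
      (S.lowerSojourn i ≤ S.refinedSojourn p i ∧ S.refinedSojourn p i ≤ S.upperSojourn i) ∧
      (S.rate i Finset.univ < S.rate i {i} →
        S.lowerSojourn i < S.refinedSojourn p i ∧ S.refinedSojourn p i < S.upperSojourn i) :=
  ⟨BTSNetwork.existsUnique_isStationary hS, fun p hp i =>
    ⟨BTSNetwork.hasSum_queueLength hS p i,
      ⟨(BTSNetwork.refinedSojourn_lower hS hp i).1, (BTSNetwork.refinedSojourn_upper hS hp i).1⟩,
      fun hlt => ⟨(BTSNetwork.refinedSojourn_lower hS hp i).2 hlt,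
        (BTSNetwork.refinedSojourn_upper hS hp i).2 hlt⟩⟩⟩
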